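/- Let $N\ge 2$, let $\mathbb T=\{z\in\mathbb C:|z|=1\}$ with Haar probability measure, and let $m_0,\dots,m_{N-1}$ be trigonometric polynomials on $\mathbb T$ that form a QMF system, i.e. $\frac1N\sum_{w^N=z}m_i(w)\overline{m_j(w)}=\delta_{ij}$ for all $i,j$ and all $z\in\mathbb T$. Let $S_if(z)=m_i(z)f(z^N)$, $f\in L^2(\mathbb T)$, be the associated wavelet representation of the Cuntz algebra $\mathcal O_N$ on $L^2(\mathbb T)$, and let $P$ be its associated projection-valued measure, i.e. the projection-valued measure on the Borel sets of $\{0,\dots,N-1\}^{\mathbb N}$ whose value on the cylinder of all infinite words that begin with $i_1\dots i_n$ is $S_{i_1}\cdots S_{i_n}(S_{i_1}\cdots S_{i_n})^*$. An atom of the representation is an infinite word $\omega$ with $P(\{\omega\})\neq0$. Then the following are equivalent: (i) the representation has an atom; (ii) there exist $p\ge1$ and $i_0,\dots,i_{p-1}\in\{0,\dots,N-1\}$ (not necessarily distinct) such that for every $j=0,\dots,p-1$ one has $m_{i_j}(z)=a_jz^{k_j}$ with $a_j\in\mathbb T$, $k_j\in\mathbb Z$, and $k_0+Nk_1+\dots+N^{p-1}k_{p-1}$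 is a multiple of $N^p-1$. In particular, if the low-pass condition $m_0(1)=\sqrt N$ holds, then the representation has no atoms. -/

import Mathlib

open MeasureTheory Filter Topology
open scoped ENNReal ComplexConjugate

/-- A projection-valued measure on the measurable space `X`, with values in the orthogonal
projections of the Hilbert space `H`: each measurable set is sent to an orthogonal projection, the
whole space to the identity, and countable additivity holds in the strong operator topology. Sets
that are not measurable are sent to `0` by convention. -/
structure ProjectionValuedMeasure (X : Type*) [MeasurableSpace X] (H : Type*)
    [NormedAddCommGroup H] [InnerProductSpace ℂ H] [CompleteSpace H] where
  /-- The projection of a set. -/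
  proj : Set X → H →L[ℂ] H
  isStarProjection : ∀ A : Set X, MeasurableSet A → IsStarProjection (proj A)
  proj_univ : proj Set.univ = 1
  hasSum_iUnion : ∀ A : ℕ → Set X, (∀ n, MeasurableSet (A n)) →
    Pairwise (Function.onFun Disjoint A) →
    ∀ x : H, HasSum (fun n => proj (A n) x) (proj (⋃ n, A n) x)
  proj_of_not_measurableSet : ∀ A : Set X, ¬ MeasurableSet A → proj A = 0

/-- A representation of the Cuntz algebra `𝒪_N`, `N ≥ 2`, on the Hilbert space `H`: operators
`S 0, …, S (N - 1)` with `S iᴴ S j = δ_ij` and `∑ i, S i S iᴴ = 1`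
(`star` is the Hilbert space adjoint). -/
structure CuntzRep (N : ℕ) (H : Type*)
    [NormedAddCommGroup H] [InnerProductSpace ℂ H] [CompleteSpace H] where
  two_le : 2 ≤ N
  /-- The Cuntz isometries. -/
  S : Fin N → H →L[ℂ] H
  star_mul_mul : ∀ i j, star (S i) * S j = if i = j then 1 else 0
  sum_mul_star : ∑ i, S i * star (S i) = 1

/-- The cylinder set of all infinite words that begin with the finite word `I`. -/
def wordCylinder {N : ℕ} (I : List (Fin N)) : Set (ℕ → Fin N) :=
  {ω | ∀ (k : ℕ) (hk : k < I.length), ω k = I[k]}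

section ProjectionLemmas

variable {H : Type*} [NormedAddCommGroup H] [InnerProductSpace ℂ H] [CompleteSpace H]

theorem starProjection_inner_self {P : H →L[ℂ] H} (hP : IsStarProjection P) (x : H) :
    inner ℂ (P x) x = ((‖P x‖ ^ 2 : ℝ) : ℂ) := by
  have h1 : P (P x) = P x := by
    have := hP.isIdempotentElem
    exact congrArg (fun T : H →L[ℂ] H => T x) this
  have h2 : inner ℂ (P (P x)) x = inner ℂ (P x) (P x) := by
    have := hP.isSelfAdjoint.isSymmetric
    exact this (P x) x
  rw [h1] at h2
  rw [h2, inner_self_eq_norm_sq_to_K]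
  norm_cast

theorem starProjection_ext {P Q : H →L[ℂ] H} (hP : IsStarProjection P) (hQ : IsStarProjection Q)
    (h : ∀ x, ‖P x‖ ^ 2 = ‖Q x‖ ^ 2) : P = Q := by
  have : (P : H →ₗ[ℂ] H) = (Q : H →ₗ[ℂ] H) := by
    rw [← ext_inner_map]
    intro x
    simp only [ContinuousLinearMap.coe_coe]
    rw [starProjection_inner_self hP, starProjection_inner_self hQ, h x]
  exact ContinuousLinearMap.coe_injective this

theorem norm_sq_one_sub {P : H →L[ℂ] H} (hP : IsStarProjection P) (x : H) :
    ‖(1 - P) x‖ ^ 2 = ‖x‖ ^ 2 - ‖P x‖ ^ 2 := by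
  have h1 := starProjection_inner_self hP x
  have h2 := starProjection_inner_self hP.one_sub x
  have h3 : inner ℂ ((1 - P) x) x = inner ℂ x x - inner ℂ (P x) x := by
    simp
  rw [h3, h1, inner_self_eq_norm_sq_to_K] at h2
  have : ((‖x‖ ^ 2 - ‖P x‖ ^ 2 : ℝ) : ℂ) = ((‖(1 - P) x‖ ^ 2 : ℝ) : ℂ) := by
    rw [← h2]; push_cast; rfl
  exact_mod_cast this.symm

theorem isStarProjection_finsetSum {ι : Type*} {Q : ι → H →L[ℂ] H}
    (hQ : ∀ n, IsStarProjection (Q n)) (hd : ∀ i j, i ≠ j → Q i * Q j = 0) (s : Finset ι) :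
    IsStarProjection (∑ n ∈ s, Q n) := by
  classical
  induction s using Finset.induction_on with
  | empty => simp
  | insert a s ha ih =>
    rw [Finset.sum_insert ha]
    refine (hQ a).add ih ?_
    rw [Finset.mul_sum]
    exact Finset.sum_eq_zero fun j hj => hd _ _ (fun h => ha (h ▸ hj))

theorem exists_hasSum_starProjection {Q : ℕ → H →L[ℂ] H}
    (hQ : ∀ n, IsStarProjection (Q n)) (hd : ∀ i j, i ≠ j → Q i * Q j = 0) :
    ∃ P : H →L[ℂ] H, IsStarProjection P ∧ ∀ x, HasSum (fun n => Q n x) (P x) := by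
  classical
  have hs := isStarProjection_finsetSum hQ hd
  choose U hU using fun s : Finset ℕ => isStarProjection_iff_eq_starProjection.1 (hs s)
  choose hU' hU using hU
  have hmono : Monotone U := by
    intro s t hst x hx
    have h1 : (∑ n ∈ s, Q n) x = x := by
      rw [hU s]; exact Submodule.starProjection_eq_self_iff.2 hx
    have h2 : (∑ n ∈ t, Q n) * (∑ n ∈ s, Q n) = ∑ n ∈ s, Q n := by
      rw [← Finset.sum_sdiff hst, add_mul, (hs s).isIdempotentElem, Finset.sum_mul_sum]
      rw [Finset.sum_eq_zero, zero_add]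
      intro i hi
      refine Finset.sum_eq_zero fun j hj => hd _ _ ?_
      rintro rfl
      exact (Finset.mem_sdiff.1 hi).2 hj
    have h3 : (∑ n ∈ t, Q n) x = x := by
      have := congrArg (fun T : H →L[ℂ] H => T x) h2
      change (∑ n ∈ t, Q n) ((∑ n ∈ s, Q n) x) = (∑ n ∈ s, Q n) x at this
      rwa [h1] at this
    rw [hU t] at h3
    exact Submodule.starProjection_eq_self_iff.1 h3
  refine ⟨(⨆ s, U s).topologicalClosure.starProjection, isStarProjection_starProjection, ?_⟩
  intro x
  have := Submodule.starProjection_tendsto_closure_iSup U hmono x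
  simp only [← hU] at this
  simpa [HasSum] using this

/-- If the scalar measures of disjoint sets are given by orthogonal projections, then so is the
scalar measure of their union, by the strong sum of the projections. -/
theorem exists_starProjection_iUnion {X : Type*} [MeasurableSpace X] (μ : H → Measure X)
    (huniv : ∀ x, μ x Set.univ = ENNReal.ofReal (‖x‖ ^ 2)) {A : ℕ → Set X}
    (hA : ∀ n, MeasurableSet (A n)) (hd : Pairwise (Function.onFun Disjoint A))
    {Q : ℕ → H →L[ℂ] H} (hQ : ∀ n, IsStarProjection (Q n))
    (h : ∀ n x, μ x (A n) = ENNReal.ofReal (‖Q n x‖ ^ 2)) :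
    ∃ P : H →L[ℂ] H, IsStarProjection P ∧ (∀ x, HasSum (fun n => Q n x) (P x)) ∧
      ∀ x, μ x (⋃ n, A n) = ENNReal.ofReal (‖P x‖ ^ 2) := by
  have horth : ∀ i j, i ≠ j → Q i * Q j = 0 := by
    intro i j hij
    ext y
    set x := Q j y with hx
    have h1 : Q j x = x := congrArg (fun T : H →L[ℂ] H => T y) (hQ j).isIdempotentElem
    have h2 : μ x (A i) + μ x (A j) ≤ μ x Set.univ := by
      rw [← measure_union (hd hij) (hA j)]
      exact measure_mono (Set.subset_univ _)
    rw [h, h, huniv, h1, ← ENNReal.ofReal_add (by positivity) (by positivity),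
      ENNReal.ofReal_le_ofReal_iff (by positivity)] at h2
    have h3 : ‖Q i x‖ ^ 2 = 0 := le_antisymm (by linarith) (by positivity)
    change Q i x = 0
    simpa using h3
  obtain ⟨P, hP, hs⟩ := exists_hasSum_starProjection hQ horth
  refine ⟨P, hP, hs, fun x => ?_⟩
  rw [measure_iUnion hd hA]
  simp only [h]
  have h4 : HasSum (fun n => ‖Q n x‖ ^ 2) (‖P x‖ ^ 2) := by
    have h5 := (hs x).mapL (innerSL ℂ x)
    have e : ∀ {T : H →L[ℂ] H}, IsStarProjection T →
        innerSL ℂ x (T x) = ((‖T x‖ ^ 2 : ℝ) : ℂ) := by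
      intro T hT
      rw [innerSL_apply_apply, ← inner_conj_symm, starProjection_inner_self hT,
        Complex.conj_ofReal]
    simp only [e hP, e (hQ _)] at h5
    exact_mod_cast h5
  rw [← ENNReal.ofReal_tsum_of_nonneg (fun _ => by positivity) h4.summable, h4.tsum_eq]

/-- If the scalar measures take values given by orthogonal projections on a generating π-system,
then they do so on all measurable sets. -/
theorem exists_starProjection_of_measure {X : Type*} [mX : MeasurableSpace X]
    {C : Set (Set X)} (hgen : mX = MeasurableSpace.generateFrom C) (hpi : IsPiSystem C)
    (μ : H → Measure X) (huniv : ∀ x, μ x Set.univ = ENNReal.ofReal (‖x‖ ^ 2))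
    (hC : ∀ A ∈ C, ∃ P : H →L[ℂ] H, IsStarProjection P ∧
      ∀ x, μ x A = ENNReal.ofReal (‖P x‖ ^ 2))
    (A : Set X) (hA : MeasurableSet A) :
    ∃ P : H →L[ℂ] H, IsStarProjection P ∧ ∀ x, μ x A = ENNReal.ofReal (‖P x‖ ^ 2) := by
  induction A, hA using MeasurableSpace.induction_on_inter hgen hpi with
  | empty => exact ⟨0, .zero _, fun x => by simp⟩
  | basic A hA => exact hC A hA
  | compl A hA ih =>
    obtain ⟨P, hP, h⟩ := ih
    refine ⟨1 - P, hP.one_sub, fun x => ?_⟩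
    rw [norm_sq_one_sub hP, ENNReal.ofReal_sub _ (by positivity),
      measure_compl hA (by rw [h]; exact ENNReal.ofReal_ne_top), huniv, h]
  | iUnion A hd hA ih =>
    choose Q hQ h using ih
    obtain ⟨P, hP, -, hs⟩ := exists_starProjection_iUnion μ huniv hA hd hQ h
    exact ⟨P, hP, hs⟩

/-- The projection-valued measure with given scalar measures. -/
theorem exists_pvm_of_measure {X : Type*} [mX : MeasurableSpace X]
    {C : Set (Set X)} (hgen : mX = MeasurableSpace.generateFrom C) (hpi : IsPiSystem C)
    (μ : H → Measure X) (huniv : ∀ x, μ x Set.univ = ENNReal.ofReal (‖x‖ ^ 2))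
    (hC : ∀ A ∈ C, ∃ P : H →L[ℂ] H, IsStarProjection P ∧
      ∀ x, μ x A = ENNReal.ofReal (‖P x‖ ^ 2)) :
    ∃ P : ProjectionValuedMeasure X H, ∀ A, MeasurableSet A →
      ∀ x, μ x A = ENNReal.ofReal (‖P.proj A x‖ ^ 2) := by
  classical
  choose P hP h using exists_starProjection_of_measure hgen hpi μ huniv hC
  have key : ∀ {T : H →L[ℂ] H} {A : Set X} (hA : MeasurableSet A), IsStarProjection T →
      (∀ x, μ x A = ENNReal.ofReal (‖T x‖ ^ 2)) → T = P A hA := by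
    intro T A hA hT h'
    refine starProjection_ext hT (hP A hA) fun x => ?_
    have := (h' x).symm.trans (h A hA x)
    rwa [ENNReal.ofReal_eq_ofReal_iff (by positivity) (by positivity)] at this
  refine ⟨⟨fun A => if hA : MeasurableSet A then P A hA else 0, ?_, ?_, ?_, ?_⟩, ?_⟩
  · intro A hA
    simpa [hA] using hP A hA
  · simp only [MeasurableSet.univ, dif_pos]
    exact (key .univ (.one _) (by simpa using huniv)).symm
  · intro A hA hd x
    simp only [hA, MeasurableSet.iUnion hA, dif_pos]
    obtain ⟨T, hT, hs, hm⟩ := exists_starProjection_iUnion μ huniv hA hd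
      (fun n => hP (A n) (hA n)) (fun n x => h (A n) (hA n) x)
    rw [← key (.iUnion hA) hT hm]
    exact hs x
  · intro A hA
    simp [hA]
  · intro A hA x
    simpa [hA] using h A hA x

end ProjectionLemmas

namespace ProjectionValuedMeasure

variable {X : Type*} [mX : MeasurableSpace X] {H : Type*} [NormedAddCommGroup H]
  [InnerProductSpace ℂ H] [CompleteSpace H]

theorem proj_empty (P : ProjectionValuedMeasure X H) : P.proj ∅ = 0 := by
  ext x
  have h := P.hasSum_iUnion (fun _ => ∅) (fun _ => .empty) (fun _ _ _ => by simp) x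
  have h1 := h.summable.tendsto_atTop_zero
  exact tendsto_nhds_unique tendsto_const_nhds h1

theorem proj_compl (P : ProjectionValuedMeasure X H) {A : Set X} (hA : MeasurableSet A) :
    P.proj Aᶜ = 1 - P.proj A := by
  ext x
  let f : ℕ → Set X := fun n => if n = 0 then A else if n = 1 then Aᶜ else ∅
  have hf : ∀ n, MeasurableSet (f n) := by
    intro n
    simp only [f]
    split_ifs
    exacts [hA, hA.compl, .empty]
  have hd : Pairwise (Function.onFun Disjoint f) := by
    intro i j hij
    rw [Function.onFun, Set.disjoint_left]
    intro y
    simp only [f]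
    split_ifs <;> simp_all
  have hU : ⋃ n, f n = Set.univ := by
    refine Set.eq_univ_of_forall fun y => ?_
    by_cases hy : y ∈ A
    · exact Set.mem_iUnion.2 ⟨0, by simpa [f] using hy⟩
    · exact Set.mem_iUnion.2 ⟨1, by simpa [f] using hy⟩
  have h := P.hasSum_iUnion f hf hd x
  have h2 : HasSum (fun n => P.proj (f n) x) (∑ n ∈ Finset.range 2, P.proj (f n) x) := by
    refine hasSum_sum_of_ne_finset_zero fun n hn => ?_
    have h0 : n ≠ 0 := by rintro rfl; simp at hn
    have h1 : n ≠ 1 := by rintro rfl; simp at hn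
    simp [f, h0, h1, P.proj_empty]
  have h3 := h.unique h2
  rw [hU, P.proj_univ] at h3
  simp [Finset.sum_range_succ, f] at h3
  rw [sub_apply, one_apply_eq_self]
  exact eq_sub_of_add_eq' h3.symm

/-- Two projection-valued measures that agree on a generating π-system are equal. -/
theorem ext_of_generateFrom {C : Set (Set X)} (hgen : mX = MeasurableSpace.generateFrom C)
    (hpi : IsPiSystem C) {P Q : ProjectionValuedMeasure X H}
    (h : ∀ A ∈ C, P.proj A = Q.proj A) : P = Q := by
  have key : ∀ A, MeasurableSet A → P.proj A = Q.proj A := by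
    intro A hA
    induction A, hA using MeasurableSpace.induction_on_inter hgen hpi with
    | empty => rw [proj_empty, proj_empty]
    | basic A hA => exact h A hA
    | compl A hA ih => rw [proj_compl _ hA, proj_compl _ hA, ih]
    | iUnion A hd hA ih =>
      ext x
      have h1 := P.hasSum_iUnion A hA hd x
      simp only [ih] at h1
      exact h1.unique (Q.hasSum_iUnion A hA hd x)
  have h2 : P.proj = Q.proj := by
    funext A
    by_cases hA : MeasurableSet A
    · exact key A hA
    · rw [P.proj_of_not_measurableSet A hA, Q.proj_of_not_measurableSet A hA]
  cases P; cases Q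
  congr

end ProjectionValuedMeasure

theorem measurableSet_wordCylinder {N : ℕ} (I : List (Fin N)) :
    MeasurableSet (wordCylinder I) := by
  have : wordCylinder I = ⋂ k : Fin I.length, (fun ω : ℕ → Fin N => ω k) ⁻¹' {I[k]} := by
    ext ω
    simp [wordCylinder, Fin.forall_iff]
  rw [this]
  exact .iInter fun k => measurable_pi_apply _ (measurableSet_singleton _)

theorem isClopen_wordCylinder {N : ℕ} (I : List (Fin N)) : IsClopen (wordCylinder I) := by
  have : wordCylinder I = ⋂ k : Fin I.length, (fun ω : ℕ → Fin N => ω k) ⁻¹' {I[k]} := by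
    ext ω
    simp [wordCylinder, Fin.forall_iff]
  rw [this]
  exact isClopen_iInter_of_finite fun k => (isClopen_discrete _).preimage (continuous_apply _)

theorem isPiSystem_wordCylinder {N : ℕ} :
    IsPiSystem (Set.range (wordCylinder : List (Fin N) → Set (ℕ → Fin N))) := by
  rintro _ ⟨I, rfl⟩ _ ⟨J, rfl⟩ ⟨ω, hI, hJ⟩
  wlog h : I.length ≤ J.length generalizing I J
  · rw [Set.inter_comm]
    exact this J I hJ hI (by omega)
  refine ⟨J, ?_⟩
  symm
  refine Set.inter_eq_right.2 fun η hη k hk => ?_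
  rw [hη k (by omega), ← hJ k (by omega), hI k hk]

theorem generateFrom_wordCylinder {N : ℕ} :
    (inferInstance : MeasurableSpace (ℕ → Fin N)) = MeasurableSpace.generateFrom
      (Set.range (wordCylinder : List (Fin N) → Set (ℕ → Fin N))) := by
  apply le_antisymm
  · refine iSup_le fun k => ?_
    rw [← measurable_iff_comap_le]
    refine @measurable_to_countable' _ _ _ _ (_) _ fun a => ?_
    have : (fun ω : ℕ → Fin N => ω k) ⁻¹' {a} =
        ⋃ I ∈ {I : List (Fin N) | I.length = k + 1 ∧ I[k]? = some a}, wordCylinder I := by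
      ext ω
      simp only [Set.mem_preimage, Set.mem_singleton_iff, Set.mem_iUnion]
      constructor
      · intro h
        refine ⟨List.ofFn fun j : Fin (k + 1) => ω j, ?_, ?_⟩
        · simp [h, -List.ofFn_succ]
        · intro j hj
          simp [-List.ofFn_succ]
      · rintro ⟨I, ⟨h1, h2⟩, h3⟩
        rw [h3 k (by omega)]
        rw [List.getElem?_eq_getElem (by omega)] at h2
        exact Option.some.inj h2
    rw [this]
    exact @MeasurableSet.biUnion _ _ (_) _ _ (Set.to_countable _)
      fun I _ => MeasurableSpace.measurableSet_generateFrom ⟨I, rfl⟩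
  · refine MeasurableSpace.generateFrom_le ?_
    rintro _ ⟨I, rfl⟩
    exact measurableSet_wordCylinder I

namespace CuntzRep

variable {N : ℕ} {H : Type*} [NormedAddCommGroup H] [InnerProductSpace ℂ H] [CompleteSpace H]

/-- `S_I = S_{i₁} ⋯ S_{iₙ}` for a finite word `I = i₁ … iₙ`. -/
def word (R : CuntzRep N H) (I : List (Fin N)) : H →L[ℂ] H := (I.map R.S).prod

theorem star_word_mul_word (R : CuntzRep N H) (I : List (Fin N)) :
    star (R.word I) * R.word I = 1 := by
  induction I with
  | nil => simp [word]
  | cons i I ih =>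
    have h1 : R.word (i :: I) = R.S i * R.word I := by simp [word]
    have h2 := R.star_mul_mul i i
    rw [if_pos rfl] at h2
    rw [h1, star_mul, mul_assoc, ← mul_assoc (star (R.S i)), h2, one_mul, ih]

theorem isStarProjection_word (R : CuntzRep N H) (I : List (Fin N)) :
    IsStarProjection (R.word I * star (R.word I)) := by
  refine ⟨?_, by simp [IsSelfAdjoint]⟩
  change _ * _ = _
  rw [mul_assoc, ← mul_assoc (star _), star_word_mul_word, one_mul]

theorem norm_word (R : CuntzRep N H) (I : List (Fin N)) (x : H) :
    ‖R.word I x‖ = ‖x‖ := by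
  have h : inner ℂ (R.word I x) (R.word I x) = inner ℂ x x := by
    rw [← ContinuousLinearMap.adjoint_inner_left]
    congr 1
    exact congrArg (fun T : H →L[ℂ] H => T x) (R.star_word_mul_word I)
  rw [inner_self_eq_norm_sq_to_K, inner_self_eq_norm_sq_to_K] at h
  have h' : ‖R.word I x‖ ^ 2 = ‖x‖ ^ 2 := by exact_mod_cast h
  exact (pow_left_inj₀ (norm_nonneg _) (norm_nonneg _) two_ne_zero).1 h'

theorem sum_norm_sq (R : CuntzRep N H) (x : H) : ∑ i, ‖star (R.S i) x‖ ^ 2 = ‖x‖ ^ 2 := by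
  have h := congrArg (fun T : H →L[ℂ] H => inner ℂ (T x) x) R.sum_mul_star
  have h1 : ∀ i, inner ℂ ((R.S i * star (R.S i)) x) x =
      ((‖star (R.S i) x‖ ^ 2 : ℝ) : ℂ) := by
    intro i
    change inner ℂ (R.S i (star (R.S i) x)) x = _
    rw [← ContinuousLinearMap.adjoint_inner_right, ← ContinuousLinearMap.star_eq_adjoint,
      inner_self_eq_norm_sq_to_K]
    norm_cast
  simp only [sum_apply, sum_inner, h1] at h
  rw [one_apply_eq_self, inner_self_eq_norm_sq_to_K] at h
  apply Complex.ofReal_injective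
  push_cast at h ⊢
  exact h

/-- The word `i ω`. -/
def consWord (i : Fin N) (ω : ℕ → Fin N) : ℕ → Fin N
  | 0 => i
  | k + 1 => ω k

theorem measurable_consWord (i : Fin N) : Measurable (consWord i) := by
  refine measurable_pi_lambda _ fun k => ?_
  cases k with
  | zero => exact measurable_const
  | succ k => exact measurable_pi_apply k

theorem consWord_preimage (i j : Fin N) (I : List (Fin N)) :
    consWord i ⁻¹' wordCylinder (j :: I) = if i = j then wordCylinder I else ∅ := by
  ext ω
  split_ifs with h
  · subst h
    constructor
    · intro hω k hk
      exact hω (k + 1) (by simpa using hk)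
    · intro hω k hk
      cases k with
      | zero => rfl
      | succ k => exact hω k (by simpa using hk)
  · simp only [Set.mem_preimage, Set.mem_empty_iff_false, iff_false]
    intro hω
    exact h (hω 0 (by simp))

theorem exists_measure_le (R : CuntzRep N H) (n : ℕ) (x : H) :
    ∃ μ : Measure (ℕ → Fin N), ∀ I : List (Fin N), I.length ≤ n →
      μ (wordCylinder I) = ENNReal.ofReal (‖star (R.word I) x‖ ^ 2) := by
  induction n generalizing x with
  | zero =>
    have : Nonempty (Fin N) := ⟨⟨0, by have := R.two_le; omega⟩⟩
    refine ⟨ENNReal.ofReal (‖x‖ ^ 2) • Measure.dirac (fun _ => Classical.arbitrary _),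
      fun I hI => ?_⟩
    obtain rfl : I = [] := by simpa using hI
    have : wordCylinder ([] : List (Fin N)) = Set.univ := by ext; simp [wordCylinder]
    simp [this, word]
  | succ n ih =>
    choose μ hμ using ih
    refine ⟨∑ i, (μ (star (R.S i) x)).map (consWord i), fun I hI => ?_⟩
    rw [Measure.finsetSum_apply]
    simp only [Measure.map_apply (measurable_consWord _) (measurableSet_wordCylinder _)]
    cases I with
    | nil =>
      have : wordCylinder ([] : List (Fin N)) = Set.univ := by ext; simp [wordCylinder]
      have h0 : ∀ y, μ y Set.univ = ENNReal.ofReal (‖y‖ ^ 2) := by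
        intro y
        have := hμ y [] (by simp)
        simpa [‹wordCylinder ([] : List (Fin N)) = Set.univ›, word] using this
      simp only [this, Set.preimage_univ, h0]
      rw [← ENNReal.ofReal_sum_of_nonneg (fun _ _ => by positivity), R.sum_norm_sq]
      simp [word]
    | cons j I =>
      rw [Finset.sum_eq_single j]
      · rw [consWord_preimage, if_pos rfl, hμ _ I (by simpa using hI)]
        simp [word]
      · intro i _ hij
        rw [consWord_preimage, if_neg hij, measure_empty]
      · simp

theorem exists_measure (R : CuntzRep N H) (x : H) :
    ∃ μ : Measure (ℕ → Fin N), ∀ I : List (Fin N),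
      μ (wordCylinder I) = ENNReal.ofReal (‖star (R.word I) x‖ ^ 2) := by
  have hnil : wordCylinder ([] : List (Fin N)) = Set.univ := by ext; simp [wordCylinder]
  wlog hx : ‖x‖ = 1 generalizing x
  · by_cases h0 : x = 0
    · exact ⟨0, fun I => by simp [h0]⟩
    obtain ⟨μ, hμ⟩ := this ((‖x‖⁻¹ : ℂ) • x) (by simp [norm_smul, h0])
    refine ⟨ENNReal.ofReal (‖x‖ ^ 2) • μ, fun I => ?_⟩
    rw [Measure.smul_apply, hμ, smul_eq_mul, ← ENNReal.ofReal_mul (by positivity)]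
    congr 1
    rw [map_smul, norm_smul, mul_pow, ← mul_assoc]
    have : ‖x‖ ≠ 0 := by simpa using h0
    simp [this]
  choose μ hμ using fun n => R.exists_measure_le n x
  have hp : ∀ n, IsProbabilityMeasure (μ n) := by
    intro n
    refine ⟨?_⟩
    rw [← hnil, hμ n [] (by simp)]
    simp [word, hx]
  let ν : ℕ → ProbabilityMeasure (ℕ → Fin N) := fun n => ⟨μ n, hp n⟩
  let F : Ultrafilter (ProbabilityMeasure (ℕ → Fin N)) := (hyperfilter ℕ).map ν
  have hF : Tendsto ν (hyperfilter ℕ) (𝓝 F.lim) := F.le_nhds_lim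
  refine ⟨(F.lim : Measure (ℕ → Fin N)), fun I => ?_⟩
  have h1 := ProbabilityMeasure.tendsto_measure_of_null_frontier_of_tendsto' hF
    (E := wordCylinder I) (by rw [(isClopen_wordCylinder I).frontier_eq]; simp)
  have h2 : Tendsto (fun n => (ν n : Measure (ℕ → Fin N)) (wordCylinder I)) (hyperfilter ℕ)
      (𝓝 (ENNReal.ofReal (‖star (R.word I) x‖ ^ 2))) := by
    refine tendsto_const_nhds.congr' ?_
    have h3 : ∀ᶠ n in (atTop : Filter ℕ), I.length ≤ n := eventually_ge_atTop _
    have h4 : ∀ᶠ n in (hyperfilter ℕ : Filter ℕ), I.length ≤ n :=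
      Nat.hyperfilter_le_atTop h3
    filter_upwards [h4] with n hn
    exact (hμ n I hn).symm
  exact tendsto_nhds_unique h1 h2

/-- The projections `S_I S_Iᴴ` extend to a projection-valued measure. -/
theorem exists_pvm (R : CuntzRep N H) : ∃ P : ProjectionValuedMeasure (ℕ → Fin N) H,
    ∀ I : List (Fin N), P.proj (wordCylinder I) = R.word I * star (R.word I) := by
  choose μ hμ using R.exists_measure
  have hn : ∀ I x, ‖(R.word I * star (R.word I)) x‖ = ‖star (R.word I) x‖ :=
    fun I x => R.norm_word I _
  have huniv : ∀ x, μ x Set.univ = ENNReal.ofReal (‖x‖ ^ 2) := by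
    intro x
    have hnil : wordCylinder ([] : List (Fin N)) = Set.univ := by ext; simp [wordCylinder]
    rw [← hnil, hμ]
    simp [word]
  obtain ⟨P, hP⟩ := exists_pvm_of_measure generateFrom_wordCylinder isPiSystem_wordCylinder μ huniv
    (by
      rintro _ ⟨I, rfl⟩
      exact ⟨_, R.isStarProjection_word I, fun x => by rw [hn, hμ]⟩)
  refine ⟨P, fun I => ?_⟩
  refine starProjection_ext (P.isStarProjection _ (measurableSet_wordCylinder I))
    (R.isStarProjection_word I) fun x => ?_
  have := hP _ (measurableSet_wordCylinder I) x
  rw [hμ, ENNReal.ofReal_eq_ofReal_iff (by positivity) (by positivity)] at this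
  rw [hn, this]

/-- The projection-valued measure on the infinite words associated to the representation: it
extends `P(C(I)) = S_I S_Iᴴ` from the cylinder sets to all Borel sets. -/
noncomputable def pvm (R : CuntzRep N H) : ProjectionValuedMeasure (ℕ → Fin N) H :=
  R.exists_pvm.choose

theorem pvm_wordCylinder (R : CuntzRep N H) (I : List (Fin N)) :
    R.pvm.proj (wordCylinder I) = R.word I * star (R.word I) :=
  R.exists_pvm.choose_spec I

theorem pvm_unique (R : CuntzRep N H) {P : ProjectionValuedMeasure (ℕ → Fin N) H}
    (hP : ∀ I : List (Fin N), P.proj (wordCylinder I) = R.word I * star (R.word I)) :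
    P = R.pvm := by
  refine ProjectionValuedMeasure.ext_of_generateFrom generateFrom_wordCylinder
    isPiSystem_wordCylinder ?_
  rintro _ ⟨I, rfl⟩
  rw [hP, pvm_wordCylinder]

/-- The infinite word `ω` is an atom of the representation. -/
def IsAtom (R : CuntzRep N H) (ω : ℕ → Fin N) : Prop := R.pvm.proj {ω} ≠ 0

/-- The representation has an atom. -/
def HasAtom (R : CuntzRep N H) : Prop := ∃ ω, R.IsAtom ω

end CuntzRep

/-- The Borel σ-algebra of the unit circle. -/
noncomputable instance instMeasurableSpaceCircle : MeasurableSpace Circle := borel Circle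

instance instBorelSpaceCircle : BorelSpace Circle := ⟨rfl⟩

/-- The Haar probability measure on the unit circle. -/
noncomputable def circleHaar : Measure Circle := Measure.haarMeasure ⊤

instance instIsProbabilityMeasureCircleHaar : IsProbabilityMeasure circleHaar :=
  ⟨Measure.haarMeasure_self⟩

instance instIsHaarMeasureCircleHaar : circleHaar.IsHaarMeasure :=
  Measure.isHaarMeasure_haarMeasure _

/-- A QMF system: `(1/N) ∑_{w^N = z} m_i(w) conj (m_j(w)) = δ_ij` for all `z` on the circle. -/
def IsQMF {N : ℕ} (m : Fin N → C(Circle, ℂ)) : Prop :=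
  ∀ (i j : Fin N) (z : Circle),
    (1 / (N : ℂ)) * ∑ᶠ w ∈ {w : Circle | w ^ N = z}, m i w * conj (m j w) = if i = j then 1 else 0

/-- `f` is a trigonometric polynomial, `f(z) = ∑ c_n z^n` with finitely many nonzero `c_n`,
`n ∈ ℤ`. -/
def IsTrigPolynomial (f : C(Circle, ℂ)) : Prop :=
  ∃ c : ℤ →₀ ℂ, ∀ z : Circle, f z = c.sum fun n a => a * (z : ℂ) ^ n

theorem circle_pow_surjective {N : ℕ} (hN : N ≠ 0) :
    Function.Surjective (fun z : Circle => z ^ N) := by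
  intro z
  refine ⟨Circle.exp (Complex.arg z / N), ?_⟩
  have : (N : ℝ) ≠ 0 := by exact_mod_cast hN
  simp only
  rw [← Circle.exp_nsmul, nsmul_eq_mul, mul_div_cancel₀ _ this, Circle.exp_arg]

theorem measurePreserving_circle_pow {N : ℕ} (hN : N ≠ 0) :
    MeasurePreserving (fun z : Circle => z ^ N) circleHaar circleHaar :=
  (powMonoidHom N : Circle →* Circle).measurePreserving (continuous_pow N)
    (circle_pow_surjective hN) rfl

/-- The operator `f(z) ↦ m(z) f(z^N)` on `L²` of the circle. -/
noncomputable def waveletOp {N : ℕ} (hN : 2 ≤ N) (m : C(Circle, ℂ)) :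
    Lp ℂ 2 circleHaar →L[ℂ] Lp ℂ 2 circleHaar :=
  ((ContinuousLinearMap.mul ℂ ℂ).holderL circleHaar ∞ 2 2 (ContinuousMap.toLp ∞ circleHaar ℂ m)) ∘L
    (Lp.compMeasurePreservingₗᵢ ℂ (fun z : Circle => z ^ N)
      (measurePreserving_circle_pow (by omega))).toContinuousLinearMap

theorem coeFn_waveletOp {N : ℕ} (hN : 2 ≤ N) (m : C(Circle, ℂ)) (f : Lp ℂ 2 circleHaar) :
    waveletOp hN m f =ᵐ[circleHaar] fun z => m z * f (z ^ N) := by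
  have h1 := (ContinuousLinearMap.mul ℂ ℂ).coeFn_holder (r := 2) (ContinuousMap.toLp ∞ circleHaar ℂ m)
    (Lp.compMeasurePreserving (fun z : Circle => z ^ N)
      (measurePreserving_circle_pow (by omega)) f)
  have h2 := ContinuousMap.coeFn_toLp (p := ∞) (𝕜 := ℂ) circleHaar m
  have h3 := Lp.coeFn_compMeasurePreserving f
    (measurePreserving_circle_pow (show N ≠ 0 by omega))
  have h4 : waveletOp hN m f = (ContinuousLinearMap.mul ℂ ℂ).holder 2
    (ContinuousMap.toLp ∞ circleHaar ℂ m) (Lp.compMeasurePreserving (fun z : Circle => z ^ N)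
      (measurePreserving_circle_pow (by omega)) f) := rfl
  rw [h4]
  filter_upwards [h1, h2, h3] with z h1 h2 h3
  rw [h1, h2, h3]
  rfl

section QMF

variable {N : ℕ}

/-- A primitive `N`-th root of unity. -/
noncomputable def circleRoot (N : ℕ) : Circle := Circle.exp (2 * Real.pi / N)

theorem isPrimitiveRoot_circleRoot (hN : N ≠ 0) :
    IsPrimitiveRoot ((circleRoot N : Circle) : ℂ) N := by
  have := Complex.isPrimitiveRoot_exp N hN
  convert this using 1
  rw [circleRoot, Circle.coe_exp]
  congr 1
  push_cast
  ring

theorem bijOn_fiber (hN : N ≠ 0) (z : Circle) :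
    Set.BijOn (fun k : Fin N => circleRoot N ^ (k : ℕ) * z) Set.univ {w | w ^ N = z ^ N} := by
  have hp := isPrimitiveRoot_circleRoot hN
  have h1 : circleRoot N ^ N = 1 := by
    apply Circle.ext
    simpa using hp.pow_eq_one
  refine ⟨fun k _ => ?_, fun k _ l _ h => ?_, fun w hw => ?_⟩
  · simp only [Set.mem_ofPred_eq]
    rw [mul_pow, ← pow_mul, mul_comm, mul_comm (k : ℕ), pow_mul, h1, one_pow, mul_one]
  · have h2 := mul_right_cancel h
    have h3 := congrArg (fun w : Circle => (w : ℂ)) h2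
    simp only [Circle.coe_pow] at h3
    exact Fin.ext (hp.pow_inj k.2 l.2 h3)
  · have h2 : (w / z) ^ N = 1 := by rw [div_pow, hw, div_self']
    have : NeZero N := ⟨hN⟩
    obtain ⟨k, hk, hk'⟩ := hp.eq_pow_of_pow_eq_one (ξ := ((w / z : Circle) : ℂ)) (by
      rw [← Circle.coe_pow, h2, Circle.coe_one])
    refine ⟨⟨k, hk⟩, trivial, ?_⟩
    have h3 : circleRoot N ^ k = w / z := by
      apply Circle.ext
      rw [Circle.coe_pow, hk']
    simp only [h3, div_mul_cancel]

theorem IsQMF.sum_root {m : Fin N → C(Circle, ℂ)} (hm : IsQMF m) (hN : N ≠ 0) (i j : Fin N)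
    (z : Circle) :
    (1 / (N : ℂ)) * ∑ k : Fin N, m i (circleRoot N ^ (k : ℕ) * z) *
      conj (m j (circleRoot N ^ (k : ℕ) * z)) = if i = j then 1 else 0 := by
  rw [← hm i j (z ^ N)]
  congr 1
  rw [← finsum_eq_sum_of_fintype, ← finsum_mem_univ]
  exact finsum_mem_eq_of_bijOn _ (bijOn_fiber hN z) fun _ _ => rfl

/-- The filter matrix is unitary, hence its columns are orthonormal too. -/
theorem IsQMF.sum_filter {m : Fin N → C(Circle, ℂ)} (hm : IsQMF m) (hN : N ≠ 0) (k l : Fin N)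
    (z : Circle) :
    (1 / (N : ℂ)) * ∑ i : Fin N, conj (m i (circleRoot N ^ (k : ℕ) * z)) *
      m i (circleRoot N ^ (l : ℕ) * z) = if k = l then 1 else 0 := by
  let A : Matrix (Fin N) (Fin N) ℂ := fun i k => m i (circleRoot N ^ (k : ℕ) * z)
  let B : Matrix (Fin N) (Fin N) ℂ := fun k i =>
    (1 / (N : ℂ)) * conj (m i (circleRoot N ^ (k : ℕ) * z))
  have h1 : A * B = 1 := by
    ext i j
    rw [Matrix.mul_apply, Matrix.one_apply, ← hm.sum_root hN i j z, Finset.mul_sum]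
    exact Finset.sum_congr rfl fun k _ => by simp only [A, B]; ring
  have h2 : B * A = 1 := mul_eq_one_comm.1 h1
  have h3 := congrFun (congrFun h2 k) l
  rw [Matrix.mul_apply, Matrix.one_apply] at h3
  rw [← h3, Finset.mul_sum]
  exact Finset.sum_congr rfl fun i _ => by simp only [A, B]; ring

theorem integral_average (hN : N ≠ 0) {K : Circle → ℂ} (hK : Integrable K circleHaar) :
    ∫ z, (1 / (N : ℂ)) * ∑ k : Fin N, K (circleRoot N ^ (k : ℕ) * z) ∂circleHaar =
      ∫ z, K z ∂circleHaar := by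
  rw [integral_const_mul, integral_finsetSum _ fun k _ => hK.comp_mul_left _]
  simp only [integral_mul_left_eq_self]
  have : (N : ℂ) ≠ 0 := by exact_mod_cast hN
  simp [this]

theorem IsQMF.inner_waveletOp {m : Fin N → C(Circle, ℂ)} (hm : IsQMF m) (hN : 2 ≤ N)
    (i j : Fin N) (f g : Lp ℂ 2 circleHaar) :
    inner ℂ (waveletOp hN (m i) f) (waveletOp hN (m j) g) = if i = j then inner ℂ f g else 0 := by
  have hN0 : N ≠ 0 := by omega
  let K : Circle → ℂ := fun z => (m j z * conj (m i z)) * (g (z ^ N) * conj (f (z ^ N)))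
  have hK : (fun z => inner ℂ (waveletOp hN (m i) f z) (waveletOp hN (m j) g z)) =ᵐ[circleHaar]
      K := by
    filter_upwards [coeFn_waveletOp hN (m i) f, coeFn_waveletOp hN (m j) g] with z h1 h2
    rw [h1, h2, RCLike.inner_apply, map_mul]
    simp only [K]
    ring
  have hKi : Integrable K circleHaar := (L2.integrable_inner _ _).congr hK
  rw [L2.inner_def, integral_congr_ae hK, ← integral_average hN0 hKi]
  have hpow : ∀ (k : Fin N) (z : Circle), (circleRoot N ^ (k : ℕ) * z) ^ N = z ^ N :=
    fun k z => (bijOn_fiber hN0 z).mapsTo (Set.mem_univ k)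
  have e : ∀ z, (1 / (N : ℂ)) * ∑ k : Fin N, K (circleRoot N ^ (k : ℕ) * z) =
      (if j = i then 1 else 0) * (g (z ^ N) * conj (f (z ^ N))) := by
    intro z
    rw [← hm.sum_root hN0 j i z]
    simp only [K, hpow]
    rw [← Finset.sum_mul, mul_assoc]
  simp only [e]
  rw [integral_const_mul]
  by_cases hij : i = j
  · subst hij
    rw [if_pos rfl, if_pos rfl, one_mul, L2.inner_def]
    have hmp := measurePreserving_circle_pow hN0
    have hint := L2.integrable_inner (𝕜 := ℂ) f g
    have := integral_map (μ := circleHaar) hmp.measurable.aemeasurable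
      (f := fun z => inner ℂ (f z) (g z)) (by rw [hmp.map_eq]; exact hint.1)
    rw [hmp.map_eq] at this
    rw [this]
    rfl
  · rw [if_neg (Ne.symm hij), if_neg hij, zero_mul]

theorem IsQMF.star_mul_waveletOp {m : Fin N → C(Circle, ℂ)} (hm : IsQMF m) (hN : 2 ≤ N)
    (i j : Fin N) :
    star (waveletOp hN (m i)) * waveletOp hN (m j) = if i = j then 1 else 0 := by
  refine ContinuousLinearMap.ext fun f => ext_inner_left ℂ fun g => ?_
  change inner ℂ g (star (waveletOp hN (m i)) (waveletOp hN (m j) f)) = _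
  rw [ContinuousLinearMap.star_eq_adjoint, ContinuousLinearMap.adjoint_inner_right,
    hm.inner_waveletOp]
  split_ifs <;> simp

/-- Every continuous function is `∑ m_i(z) f_i(z^N)` for suitable continuous `f_i`. -/
theorem IsQMF.exists_decomposition {m : Fin N → C(Circle, ℂ)} (hm : IsQMF m) (hN : N ≠ 0)
    (f : C(Circle, ℂ)) :
    ∃ F : Fin N → C(Circle, ℂ), ∀ z, f z = ∑ i, m i z * F i (z ^ N) := by
  let P : C(Circle, Circle) := ⟨fun z => z ^ N, continuous_pow N⟩
  have hP : IsQuotientMap P :=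
    P.continuous.isClosedMap.isQuotientMap P.continuous (circle_pow_surjective hN)
  let G : Fin N → C(Circle, ℂ) := fun i =>
    ⟨fun z => (1 / (N : ℂ)) * ∑ k : Fin N, conj (m i (circleRoot N ^ (k : ℕ) * z)) *
      f (circleRoot N ^ (k : ℕ) * z), by fun_prop⟩
  have hG : ∀ i z, G i z =
      (1 / (N : ℂ)) * ∑ᶠ w ∈ {w : Circle | w ^ N = z ^ N}, conj (m i w) * f w := by
    intro i z
    simp only [G, ContinuousMap.coe_mk]
    congr 1
    rw [← finsum_eq_sum_of_fintype, ← finsum_mem_univ]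
    exact finsum_mem_eq_of_bijOn _ (bijOn_fiber hN z) fun _ _ => rfl
  have hfac : ∀ i, Function.FactorsThrough (G i) P := by
    intro i z w hzw
    have : z ^ N = w ^ N := hzw
    rw [hG, hG, this]
  refine ⟨fun i => hP.lift (G i) (hfac i), fun z => ?_⟩
  have h1 : ∀ i, hP.lift (G i) (hfac i) (z ^ N) = G i z := by
    intro i
    have := hP.lift_comp (G i) (hfac i)
    exact congrArg (fun g : C(Circle, ℂ) => g z) this
  simp only [h1, G, ContinuousMap.coe_mk]

  have h2 : ∀ k : Fin N, (1 / (N : ℂ)) * ∑ i : Fin N,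
      conj (m i (circleRoot N ^ (k : ℕ) * z)) * m i z =
        if k = ⟨0, by omega⟩ then 1 else 0 := by
    intro k
    have := hm.sum_filter hN k ⟨0, by omega⟩ z
    simpa using this
  calc f z = ∑ k : Fin N, (if k = ⟨0, by omega⟩ then 1 else 0) *
        f (circleRoot N ^ (k : ℕ) * z) := by simp
    _ = _ := by
      simp only [← h2, Finset.mul_sum, Finset.sum_mul]
      rw [Finset.sum_comm]
      exact Finset.sum_congr rfl fun i _ => Finset.sum_congr rfl fun k _ => by ring

theorem IsQMF.sum_mul_star_waveletOp {m : Fin N → C(Circle, ℂ)} (hm : IsQMF m) (hN : 2 ≤ N) :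
    ∑ i, waveletOp hN (m i) * star (waveletOp hN (m i)) = 1 := by
  have hrange : ∀ F : Fin N → Lp ℂ 2 circleHaar,
      (∑ i, waveletOp hN (m i) * star (waveletOp hN (m i)))
        (∑ j, waveletOp hN (m j) (F j)) = ∑ j, waveletOp hN (m j) (F j) := by
    intro F
    rw [sum_apply]
    refine Finset.sum_congr rfl fun i _ => ?_
    change waveletOp hN (m i) (star (waveletOp hN (m i)) _) = _
    congr 1
    rw [map_sum, Finset.sum_eq_single i]
    · have h := hm.star_mul_waveletOp hN i i
      rw [if_pos rfl] at h
      exact congrArg (fun T : Lp ℂ 2 circleHaar →L[ℂ] Lp ℂ 2 circleHaar => T (F i)) h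
    · intro j _ hj
      have h := hm.star_mul_waveletOp hN i j
      rw [if_neg (Ne.symm hj)] at h
      exact congrArg (fun T : Lp ℂ 2 circleHaar →L[ℂ] Lp ℂ 2 circleHaar => T (F j)) h
    · simp
  have hdense := ContinuousMap.toLp_denseRange ℂ circleHaar ℂ (p := 2) (by simp)
  refine ContinuousLinearMap.ext fun x => ?_
  refine hdense.induction_on (p := fun x => (∑ i, waveletOp hN (m i) *
    star (waveletOp hN (m i))) x = (1 : Lp ℂ 2 circleHaar →L[ℂ] Lp ℂ 2 circleHaar) x) x
    (isClosed_eq (ContinuousLinearMap.continuous _) (ContinuousLinearMap.continuous _)) ?_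
  intro f
  obtain ⟨F, hF⟩ := hm.exists_decomposition (by omega) f
  have : ContinuousMap.toLp 2 circleHaar ℂ f =
      ∑ j, waveletOp hN (m j) (ContinuousMap.toLp 2 circleHaar ℂ (F j)) := by
    have h1 : ∀ j, waveletOp hN (m j) (ContinuousMap.toLp 2 circleHaar ℂ (F j)) =
        ContinuousMap.toLp 2 circleHaar ℂ
          (m j * (F j).comp ⟨fun z => z ^ N, continuous_pow N⟩) := by
      intro j
      apply Lp.ext
      have hq := (measurePreserving_circle_pow (show N ≠ 0 by omega)).quasiMeasurePreserving
      have h2 := hq.ae_eq_comp (ContinuousMap.coeFn_toLp (p := 2) (𝕜 := ℂ) circleHaar (F j))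
      filter_upwards [coeFn_waveletOp hN (m j) (ContinuousMap.toLp 2 circleHaar ℂ (F j)), h2,
        ContinuousMap.coeFn_toLp (p := 2) (𝕜 := ℂ) circleHaar
          (m j * (F j).comp ⟨fun z => z ^ N, continuous_pow N⟩)] with z h3 h4 h5
      rw [h3, h5]
      simp only [Function.comp_apply] at h4
      rw [h4]
      rfl
    simp only [h1]
    rw [← map_sum]
    congr 1
    ext z
    simp [hF z]
  rw [this, hrange]
  rfl

end QMF

/-- The wavelet representation `S_i f(z) = m_i(z) f(z^N)` on `L²` of the circle, associated to a
QMF system. -/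
noncomputable def waveletRep {N : ℕ} (hN : 2 ≤ N) (m : Fin N → C(Circle, ℂ)) (hm : IsQMF m) :
    CuntzRep N (Lp ℂ 2 circleHaar) where
  two_le := hN
  S i := waveletOp hN (m i)
  star_mul_mul i j := hm.star_mul_waveletOp hN i j
  sum_mul_star := hm.sum_mul_star_waveletOp hN

/-!
Suppose `P {ω} x ≠ 0`, and let `I` be the word of the first `n` letters of `ω`. The operator `S_I*`
carries the range of `P {ω}` isometrically into the range of the projection at the shifted word,
and `S_I* (x - P {ω} x)` tends to `0` as `n` grows. Since `z ↦ z ^ N` expands frequencies, a large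
enough space `V` of trigonometric polynomials with bounded frequencies is invariant under all
`S_i*`. Taking `x` in `V`, compactness of the balls of `V` and the orthogonality of the ranges at
distinct words force `ω` to be eventually periodic; for a period `I` of its tail `ν`, `S_I*` has an
eigenvector in `V` that lies in the range of `P {ν}`, and this is an eigenvector of `S_I`.

The operator `S_i` multiplies the degree spread of a trigonometric polynomial by `N` and adds that
of `m_i`. An eigenvector of `S_I` therefore has spread `0`, as do the filters in `I`: all of them
are monomials. Comparing exponents in `S_I z ^ l = c z ^ l` gives `∑ N ^ j k_j + N ^ p l = l`, which
is the divisibility; conversely, any solution `l` gives an eigenvector `z ^ l`, fixed by the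
projection at the periodic word `I I I ⋯`. Under the low-pass condition, `∑ |m_i(1)| ^ 2 = N` makes
every `|m_i(1)|` equal to `√N` or `0`, so no filter is a monomial.
-/

/-! ### Projection-valued measures -/

namespace ProjectionValuedMeasure

variable {X : Type*} [MeasurableSpace X] {H : Type*} [NormedAddCommGroup H]
  [InnerProductSpace ℂ H] [CompleteSpace H]

/-- The `H`-valued measure `A ↦ P A x`, through which the general theory of vector measures applies
to a projection-valued measure. -/
noncomputable def vectorMeasure (P : ProjectionValuedMeasure X H) (x : H) : VectorMeasure X H where
  measureOf' A := P.proj A x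
  empty' := by rw [P.proj_empty, zero_apply]
  not_measurable' A hA := by rw [P.proj_of_not_measurableSet A hA, zero_apply]
  m_iUnion' A hA hd := P.hasSum_iUnion A hA hd x

theorem proj_sdiff (P : ProjectionValuedMeasure X H) {A B : Set X} (hA : MeasurableSet A)
    (hB : MeasurableSet B) (h : A ⊆ B) : P.proj (B \ A) = P.proj B - P.proj A := by
  ext x
  exact (P.vectorMeasure x).of_sdiff hA hB h

theorem tendsto_proj_iInter (P : ProjectionValuedMeasure X H) {A : ℕ → Set X} (hA : Antitone A)
    (hmeas : ∀ n, MeasurableSet (A n)) (x : H) :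
    Tendsto (fun n => P.proj (A n) x) atTop (𝓝 (P.proj (⋂ n, A n) x)) :=
  (P.vectorMeasure x).tendsto_vectorMeasure_iInter_atTop_nat hA hmeas

theorem proj_mul_proj_of_subset_left (P : ProjectionValuedMeasure X H) {A B : Set X}
    (hA : MeasurableSet A) (hB : MeasurableSet B) (h : A ⊆ B) :
    P.proj A * P.proj B = P.proj A := by
  have hsub : IsStarProjection (P.proj B - P.proj A) := by
    rw [← P.proj_sdiff hA hB h]
    exact P.isStarProjection _ (hB.diff hA)
  have : IsAddTorsionFree (H →L[ℂ] H) := .of_isTorsionFree ℂ _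
  exact ((P.isStarProjection A hA).sub_iff_mul_eq_left (P.isStarProjection B hB)).1 hsub

theorem proj_mul_proj_of_subset_right (P : ProjectionValuedMeasure X H) {A B : Set X}
    (hA : MeasurableSet A) (hB : MeasurableSet B) (h : A ⊆ B) :
    P.proj B * P.proj A = P.proj A := by
  simpa [(P.isStarProjection A hA).isSelfAdjoint.star_eq,
    (P.isStarProjection B hB).isSelfAdjoint.star_eq] using
    congrArg star (P.proj_mul_proj_of_subset_left hA hB h)

theorem proj_mul_proj_of_disjoint (P : ProjectionValuedMeasure X H) {A B : Set X}
    (hA : MeasurableSet A) (hB : MeasurableSet B) (h : Disjoint A B) :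
    P.proj A * P.proj B = 0 := by
  have hsub := P.proj_mul_proj_of_subset_left hA hB.compl h.subset_compl_right
  rwa [P.proj_compl hB, mul_sub, mul_one, sub_eq_self] at hsub

theorem norm_proj_apply_le (P : ProjectionValuedMeasure X H) {A : Set X} (hA : MeasurableSet A)
    (x : H) : ‖P.proj A x‖ ≤ ‖x‖ :=
  (P.proj A).le_of_opNorm_le_of_le (P.isStarProjection A hA).norm_le le_rfl |>.trans_eq (one_mul _)

/-- The ranges of the projections of distinct points are orthogonal, so the points cannot keep
changing along a sequence with nonzero limit. -/
theorem exists_eventually_eq_of_tendsto [MeasurableSingletonClass X]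
    (P : ProjectionValuedMeasure X H) {a : ℕ → X} {u : ℕ → H} {y : H}
    (hu : ∀ n, P.proj {a n} (u n) = u n) (hlim : Tendsto u atTop (𝓝 y)) (hy : y ≠ 0) :
    ∃ b, (∀ᶠ n in atTop, a n = b) ∧ P.proj {b} y = y := by
  have hle_of_ne {n k : ℕ} (h : a n ≠ a k) : ‖u n‖ ≤ ‖u n - u k‖ := by
    have horth : P.proj {a n} (u k) = 0 := by
      rw [← hu k, ← mul_apply_eq_comp, P.proj_mul_proj_of_disjoint
        (measurableSet_singleton _) (measurableSet_singleton _) (Set.disjoint_singleton.2 h),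
        zero_apply]
    simpa only [map_sub, hu n, horth, sub_zero] using
      P.norm_proj_apply_le (measurableSet_singleton (a n)) (u n - u k)
  have hnear : ∀ᶠ n in atTop, ‖u n - y‖ < ‖y‖ / 4 :=
    (tendsto_iff_norm_sub_tendsto_zero.1 hlim).eventually_lt_const (by positivity)
  obtain ⟨k, hk⟩ := hnear.exists
  have hconst : ∀ᶠ n in atTop, a n = a k := by
    filter_upwards [hnear] with n hn
    by_contra hne
    have hle := hle_of_ne hne
    have htri := norm_sub_le_norm_sub_add_norm_sub (u n) y (u k)
    rw [norm_sub_rev y] at htri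
    linarith [norm_sub_norm_le y (u n), norm_sub_rev y (u n), norm_pos_iff.2 hy]
  refine ⟨a k, hconst, ?_⟩
  refine tendsto_nhds_unique (((P.proj {a k}).continuous.tendsto y).comp hlim) (hlim.congr' ?_)
  filter_upwards [hconst] with n hn
  rw [Function.comp_apply, ← hn, hu n]

end ProjectionValuedMeasure

/-! ### Atoms of representations of the Cuntz algebra -/

/-- The finite word formed by the first `n` letters of an infinite word; the infinite words are
cut as `ω = (ω 0 ⋯ ω (n - 1)) (fun k => ω (n + k))`. -/
def prefixWord {α : Type*} (ω : ℕ → α) (n : ℕ) : List α := List.ofFn fun k : Fin n => ω k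

theorem prefixWord_add {α : Type*} (ω : ℕ → α) (n k : ℕ) :
    prefixWord ω (n + k) = prefixWord ω n ++ prefixWord (fun j => ω (n + j)) k :=
  List.ofFn_add ..

theorem mem_wordCylinder_prefixWord {N : ℕ} {ω η : ℕ → Fin N} {n : ℕ} :
    η ∈ wordCylinder (prefixWord ω n) ↔ ∀ k < n, η k = ω k := by
  simp [wordCylinder, prefixWord]

theorem antitone_wordCylinder_prefixWord {N : ℕ} (ω : ℕ → Fin N) :
    Antitone fun n => wordCylinder (prefixWord ω n) := fun n k hnk η hη => by
  rw [mem_wordCylinder_prefixWord] at hη ⊢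
  exact fun j hj => hη j (hj.trans_le hnk)

theorem iInter_wordCylinder_prefixWord {N : ℕ} (ω : ℕ → Fin N) :
    ⋂ n, wordCylinder (prefixWord ω n) = {ω} := by
  ext η
  simp only [Set.mem_iInter, mem_wordCylinder_prefixWord, Set.mem_singleton_iff]
  exact ⟨fun h => funext fun k => h (k + 1) k k.lt_succ_self, fun h _ _ _ => h ▸ rfl⟩

namespace CuntzRep

variable {N : ℕ} {H : Type*} [NormedAddCommGroup H] [InnerProductSpace ℂ H] [CompleteSpace H]

theorem word_nil (R : CuntzRep N H) : R.word [] = 1 := rfl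

theorem word_cons (R : CuntzRep N H) (i : Fin N) (I : List (Fin N)) :
    R.word (i :: I) = R.S i * R.word I := by
  simp only [word, List.map_cons, List.prod_cons]

theorem word_append (R : CuntzRep N H) (I J : List (Fin N)) :
    R.word (I ++ J) = R.word I * R.word J := by
  simp only [word, List.map_append, List.prod_append]

theorem word_prefixWord_add (R : CuntzRep N H) (ω : ℕ → Fin N) (n k : ℕ) :
    R.word (prefixWord ω (n + k)) =
      R.word (prefixWord ω n) * R.word (prefixWord (fun j => ω (n + j)) k) := by
  rw [prefixWord_add, word_append]

theorem star_word_apply_word (R : CuntzRep N H) (I : List (Fin N)) (x : H) :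
    star (R.word I) (R.word I x) = x := by
  rw [← mul_apply_eq_comp, star_word_mul_word, one_apply_eq_self]

theorem proj_wordCylinder_apply (R : CuntzRep N H) (I : List (Fin N)) (x : H) :
    R.pvm.proj (wordCylinder I) x = R.word I (star (R.word I) x) := by
  rw [pvm_wordCylinder, mul_apply_eq_comp]

theorem norm_star_word_apply (R : CuntzRep N H) (I : List (Fin N)) (x : H) :
    ‖star (R.word I) x‖ = ‖R.pvm.proj (wordCylinder I) x‖ := by
  rw [proj_wordCylinder_apply, norm_word]

theorem tendsto_proj_wordCylinder (R : CuntzRep N H) (ω : ℕ → Fin N) (x : H) :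
    Tendsto (fun n => R.pvm.proj (wordCylinder (prefixWord ω n)) x) atTop
      (𝓝 (R.pvm.proj {ω} x)) := by
  rw [← iInter_wordCylinder_prefixWord]
  exact R.pvm.tendsto_proj_iInter (antitone_wordCylinder_prefixWord ω)
    (fun _ => measurableSet_wordCylinder _) x

theorem proj_wordCylinder_apply_proj_singleton (R : CuntzRep N H) (ω : ℕ → Fin N) (n : ℕ) (x : H) :
    R.pvm.proj (wordCylinder (prefixWord ω n)) (R.pvm.proj {ω} x) = R.pvm.proj {ω} x := by
  have hmem : ω ∈ wordCylinder (prefixWord ω n) := mem_wordCylinder_prefixWord.2 fun _ _ => rfl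
  rw [← mul_apply_eq_comp, R.pvm.proj_mul_proj_of_subset_right (measurableSet_singleton ω)
    (measurableSet_wordCylinder _) (Set.singleton_subset_iff.2 hmem)]

theorem norm_star_word_proj_singleton (R : CuntzRep N H) (ω : ℕ → Fin N) (n : ℕ) (x : H) :
    ‖star (R.word (prefixWord ω n)) (R.pvm.proj {ω} x)‖ = ‖R.pvm.proj {ω} x‖ := by
  rw [norm_star_word_apply, proj_wordCylinder_apply_proj_singleton]

theorem star_word_proj_singleton (R : CuntzRep N H) (ω : ℕ → Fin N) (n : ℕ) (x : H) :
    star (R.word (prefixWord ω n)) (R.pvm.proj {ω} x) =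
      R.pvm.proj {fun k => ω (n + k)} (star (R.word (prefixWord ω n)) x) := by
  refine tendsto_nhds_unique ?_ (R.tendsto_proj_wordCylinder (fun k => ω (n + k)) _)
  have hlim := ((star (R.word (prefixWord ω n))).continuous.tendsto _).comp
    ((tendsto_add_atTop_iff_nat n).2 (R.tendsto_proj_wordCylinder ω x))
  refine hlim.congr fun k => ?_
  simp only [Function.comp_apply, proj_wordCylinder_apply]
  rw [add_comm, word_prefixWord_add, star_mul, mul_apply_eq_comp, mul_apply_eq_comp,
    star_word_apply_word]

theorem star_word_apply_mem (R : CuntzRep N H) {V : Submodule ℂ H}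
    (hV : ∀ i, ∀ x ∈ V, star (R.S i) x ∈ V) (I : List (Fin N)) {x : H} (hx : x ∈ V) :
    star (R.word I) x ∈ V := by
  induction I generalizing x with
  | nil => rwa [word_nil, star_one, one_apply_eq_self]
  | cons i I ih =>
    rw [word_cons, star_mul, mul_apply_eq_comp]
    exact ih (hV i x hx)

theorem tendsto_star_word_sub_proj_singleton (R : CuntzRep N H) (ω : ℕ → Fin N) (x : H) :
    Tendsto (fun n => star (R.word (prefixWord ω n)) (x - R.pvm.proj {ω} x)) atTop (𝓝 0) := by
  have hzero : R.pvm.proj {ω} (x - R.pvm.proj {ω} x) = 0 := by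
    rw [map_sub, ← mul_apply_eq_comp,
      (R.pvm.isStarProjection _ (measurableSet_singleton ω)).isIdempotentElem, sub_self]
  rw [tendsto_zero_iff_norm_tendsto_zero]
  simp only [norm_star_word_apply]
  simpa only [hzero, norm_zero] using (R.tendsto_proj_wordCylinder ω (x - R.pvm.proj {ω} x)).norm

/-- By compactness the bounded sequence `S_{ω|n}* x` in `V` accumulates at a vector of `V`, which
lies in the range of a projection `P {ν}`, where `ν` is a tail of `ω` that recurs. -/
theorem exists_periodic_of_proj_singleton_ne_zero (R : CuntzRep N H) {V : Submodule ℂ H}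
    [FiniteDimensional ℂ V] (hV : ∀ i, ∀ x ∈ V, star (R.S i) x ∈ V) {ω : ℕ → Fin N} {x : H}
    (hx : x ∈ V) (hω : R.pvm.proj {ω} x ≠ 0) :
    ∃ (ν : ℕ → Fin N) (p : ℕ), 0 < p ∧ (fun k => ν (p + k)) = ν ∧
      ∃ y ∈ V, y ≠ 0 ∧ R.pvm.proj {ν} y = y := by
  let v : ℕ → V := fun n => ⟨star (R.word (prefixWord ω n)) x, R.star_word_apply_mem hV _ hx⟩
  have hbdd : ∀ n, v n ∈ Metric.closedBall (0 : V) ‖x‖ := fun n => by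
    rw [mem_closedBall_zero_iff, Submodule.coe_norm, norm_star_word_apply]
    exact R.pvm.norm_proj_apply_le (measurableSet_wordCylinder _) x
  have : ProperSpace V := FiniteDimensional.proper ℂ V
  obtain ⟨y, -, φ, hφ, hlim⟩ := tendsto_subseq_of_bounded Metric.isBounded_closedBall hbdd
  let u : ℕ → H := fun n => star (R.word (prefixWord ω (φ n))) (R.pvm.proj {ω} x)
  have hu : Tendsto u atTop (𝓝 (y : H)) := by
    have hv : Tendsto (fun n => (v (φ n) : H)) atTop (𝓝 y) :=
      (continuous_subtype_val.tendsto y).comp hlim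
    have hsub := (R.tendsto_star_word_sub_proj_singleton ω x).comp hφ.tendsto_atTop
    simpa [u, v, Function.comp_def] using hv.sub hsub
  have hy : (y : H) ≠ 0 := by
    have hnorm : ‖(y : H)‖ = ‖R.pvm.proj {ω} x‖ := tendsto_nhds_unique hu.norm <| by
      simpa only [u, norm_star_word_proj_singleton] using tendsto_const_nhds
    rwa [← norm_ne_zero_iff, hnorm, norm_ne_zero_iff]
  have hfix : ∀ n, R.pvm.proj {fun k => ω (φ n + k)} (u n) = u n := fun n => by
    rw [← star_word_proj_singleton, ← mul_apply_eq_comp (f := R.pvm.proj {ω}),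
      (R.pvm.isStarProjection _ (measurableSet_singleton ω)).isIdempotentElem]
  obtain ⟨ν, htail, hν⟩ := R.pvm.exists_eventually_eq_of_tendsto hfix hu hy
  obtain ⟨n, hn⟩ := eventually_atTop.1 htail
  have hlt : φ n < φ (n + 1) := hφ n.lt_succ_self
  refine ⟨ν, φ (n + 1) - φ n, Nat.sub_pos_of_lt hlt, ?_, y, y.2, hy, hν⟩
  calc (fun k => ν (φ (n + 1) - φ n + k))
      = fun k => ω (φ (n + 1) + k) := by
        ext k
        rw [← hn n le_rfl, ← Nat.add_sub_cancel' hlt.le, add_assoc, Nat.add_sub_cancel_left]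
    _ = ν := hn (n + 1) n.le_succ

theorem exists_word_apply_eq_smul_of_proj_singleton_ne_zero (R : CuntzRep N H)
    {V : Submodule ℂ H} [FiniteDimensional ℂ V] (hV : ∀ i, ∀ x ∈ V, star (R.S i) x ∈ V)
    {ω : ℕ → Fin N} {x : H} (hx : x ∈ V) (hω : R.pvm.proj {ω} x ≠ 0) :
    ∃ p > 0, ∃ i : Fin p → Fin N, ∃ y ∈ V, y ≠ 0 ∧ ∃ c : ℂ, R.word (List.ofFn i) y = c • y := by
  obtain ⟨ν, p, hp, hper, y, hyV, hy, hνy⟩ := R.exists_periodic_of_proj_singleton_ne_zero hV hx hω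
  let V' : Submodule ℂ H := V ⊓ (R.pvm.proj {ν} : H →ₗ[ℂ] H).eqLocus LinearMap.id
  let T : H →ₗ[ℂ] H := (star (R.word (prefixWord ν p)) : H →L[ℂ] H)
  have hT : ∀ w ∈ V', T w ∈ V' := fun w ⟨hwV, hw⟩ => by
    refine ⟨R.star_word_apply_mem hV _ hwV, ?_⟩
    have hcomm := R.star_word_proj_singleton ν p w
    rw [hper, show R.pvm.proj {ν} w = w from hw] at hcomm
    exact hcomm.symm
  have : FiniteDimensional ℂ V' := Submodule.finiteDimensional_inf_left V _
  have : Nontrivial V' := ⟨⟨y, hyV, hνy⟩, 0, fun h => hy (congrArg Subtype.val h)⟩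
  obtain ⟨μ, hμ⟩ := Module.End.exists_eigenvalue (T.restrict hT)
  obtain ⟨⟨w, hwV, hw⟩, hw_eigen, hw0⟩ := hμ.exists_hasEigenvector
  have hTw : star (R.word (prefixWord ν p)) w = μ • w :=
    congrArg Subtype.val (Module.End.mem_eigenspace_iff.1 hw_eigen)
  have hSw : μ • R.word (prefixWord ν p) w = w := by
    rw [← map_smul, ← hTw, ← proj_wordCylinder_apply, ← show R.pvm.proj {ν} w = w from hw,
      proj_wordCylinder_apply_proj_singleton]
  have hw0 : w ≠ 0 := fun h => hw0 (Subtype.ext h)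
  have hμ0 : μ ≠ 0 := by
    rintro rfl
    exact hw0 (by rw [← hSw, zero_smul])
  exact ⟨p, hp, fun j => ν j, w, hwV, hw0, μ⁻¹, (eq_inv_smul_iff₀ hμ0).2 hSw⟩

theorem ne_zero_of_word_apply_eq_smul (R : CuntzRep N H) {I : List (Fin N)} {x : H} (hx : x ≠ 0)
    {c : ℂ} (h : R.word I x = c • x) : c ≠ 0 := by
  rintro rfl
  rw [← norm_ne_zero_iff, ← R.norm_word I, h, zero_smul, norm_zero] at hx
  exact hx rfl

theorem hasAtom_of_word_apply_eq_smul (R : CuntzRep N H) {p : ℕ} (hp : 0 < p) (i : Fin p → Fin N)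
    {x : H} (hx : x ≠ 0) {c : ℂ} (h : R.word (List.ofFn i) x = c • x) : R.HasAtom := by
  have hc : c ≠ 0 := R.ne_zero_of_word_apply_eq_smul hx h
  let ω : ℕ → Fin N := fun n => i ⟨n % p, Nat.mod_lt _ hp⟩
  have hper : (fun k => ω (p + k)) = ω := by
    simp only [ω, Nat.add_mod_left]
  have hprefix : prefixWord ω p = List.ofFn i := by
    simp only [prefixWord, ω, Nat.mod_eq_of_lt (Fin.is_lt _)]
  have hpow : ∀ n, R.word (prefixWord ω (p * n)) x = c ^ n • x := fun n => by
    induction n with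
    | zero => simp [prefixWord, word_nil]
    | succ n ih =>
      rw [mul_add_one, add_comm, word_prefixWord_add, hper, hprefix, mul_apply_eq_comp, ih,
        map_smul, h, smul_smul, pow_succ]
  have hfix : ∀ n, R.pvm.proj (wordCylinder (prefixWord ω (p * n))) x = x := fun n => by
    have hx_eq : x = R.word (prefixWord ω (p * n)) ((c ^ n)⁻¹ • x) := by
      rw [map_smul, hpow, inv_smul_smul₀ (pow_ne_zero n hc)]
    rw [proj_wordCylinder_apply, hx_eq, star_word_apply_word]
  have hωx : R.pvm.proj {ω} x = x := by
    refine tendsto_nhds_unique ((R.tendsto_proj_wordCylinder ω x).comp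
      (strictMono_mul_left_of_pos hp).tendsto_atTop) ?_
    simp only [Function.comp_def, hfix, tendsto_const_nhds]
  exact ⟨ω, fun h0 => hx (by rw [← hωx, h0, zero_apply])⟩

end CuntzRep

/-! ### Fourier analysis on the circle -/

section HilbertBasis

variable {ι 𝕜 E : Type*} [RCLike 𝕜] [NormedAddCommGroup E] [InnerProductSpace 𝕜 E]

theorem mem_span_image_hilbertBasis_iff (b : HilbertBasis ι 𝕜 E) {s : Set ι} (hs : s.Finite)
    {x : E} : x ∈ Submodule.span 𝕜 (b '' s) ↔ ∀ i ∉ s, inner 𝕜 (b i) x = 0 := by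
  refine ⟨fun hx i hi => ?_, fun h => ?_⟩
  · have hle : Submodule.span 𝕜 (b '' s) ≤ (𝕜 ∙ b i)ᗮ := by
      rw [Submodule.span_le]
      rintro _ ⟨j, hj, rfl⟩
      rw [SetLike.mem_coe, Submodule.mem_orthogonal_singleton_iff_inner_right]
      exact b.orthonormal.inner_eq_zero (ne_of_mem_of_not_mem hj hi).symm
    exact Submodule.mem_orthogonal_singleton_iff_inner_right.1 (hle hx)
  · have hsum : ∑ i ∈ hs.toFinset, inner 𝕜 (b i) x • b i = x := by
      refine (hasSum_sum_of_ne_finset_zero (L := .unconditional ι) fun i hi => ?_).unique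
        (by simpa only [b.repr_apply_apply] using b.hasSum_repr x)
      rw [h i (by simpa using hi), zero_smul]
    rw [← hsum]
    exact Submodule.sum_mem _ fun i hi => Submodule.smul_mem _ _ <|
      Submodule.subset_span ⟨i, hs.mem_toFinset.1 hi, rfl⟩

theorem exists_apply_hilbertBasis_ne_zero {F : Type*} [NormedAddCommGroup F] [NormedSpace 𝕜 F]
    (b : HilbertBasis ι 𝕜 E) {T : E →L[𝕜] F} (hT : T ≠ 0) : ∃ i, T (b i) ≠ 0 := by
  contrapose! hT
  refine ContinuousLinearMap.ext_on
    (Submodule.dense_iff_topologicalClosure_eq_top.2 b.dense_span) ?_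
  rintro _ ⟨i, rfl⟩
  rw [hT, zero_apply]

end HilbertBasis

/-- The monomial `z ↦ z ^ n` on the circle. -/
noncomputable def circleMonomial (n : ℤ) : C(Circle, ℂ) :=
  ⟨fun z => ((z ^ n : Circle) : ℂ), continuous_subtype_val.comp (continuous_zpow n)⟩

theorem circleMonomial_apply (n : ℤ) (z : Circle) : circleMonomial n z = (z : ℂ) ^ n :=
  Circle.coe_zpow z n

theorem circleMonomial_mul (k n : ℤ) :
    circleMonomial k * circleMonomial n = circleMonomial (k + n) := by
  ext z
  rw [ContinuousMap.mul_apply, circleMonomial_apply, circleMonomial_apply, circleMonomial_apply,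
    zpow_add₀ (Circle.coe_ne_zero z)]

theorem eq_smul_circleMonomial_iff {f : C(Circle, ℂ)} {c : ℂ} {n : ℤ} :
    f = c • circleMonomial n ↔ ∀ z : Circle, f z = c * (z : ℂ) ^ n := by
  simp only [ContinuousMap.ext_iff, ContinuousMap.smul_apply, circleMonomial_apply, smul_eq_mul]

theorem isTrigPolynomial_iff_mem_span {f : C(Circle, ℂ)} :
    IsTrigPolynomial f ↔ f ∈ Submodule.span ℂ (Set.range circleMonomial) := by
  simp only [IsTrigPolynomial, Finsupp.mem_span_range_iff_exists_finsupp, ContinuousMap.ext_iff,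
    Finsupp.sum, ContinuousMap.sum_apply, ContinuousMap.smul_apply, circleMonomial_apply,
    smul_eq_mul, eq_comm]

/-- The Fourier basis vector `z ^ n` of `L²` of the circle. -/
noncomputable def circleFourier (n : ℤ) : Lp ℂ 2 circleHaar :=
  ContinuousMap.toLp 2 circleHaar ℂ (circleMonomial n)

section FourierBasis

variable {T : ℝ} [hT : Fact (0 < T)]

theorem measurePreserving_toCircle :
    MeasurePreserving (AddCircle.toCircle (T := T)) AddCircle.haarAddCircle circleHaar := by
  have hmeas : Measurable (AddCircle.toCircle (T := T)) := AddCircle.continuous_toCircle.measurable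
  refine ⟨hmeas, ?_⟩
  have := Measure.isProbabilityMeasure_map (μ := AddCircle.haarAddCircle (T := T))
    hmeas.aemeasurable
  have : (Measure.map (AddCircle.toCircle (T := T))
      AddCircle.haarAddCircle).IsMulLeftInvariant := by
    refine ⟨fun z => ?_⟩
    obtain ⟨a, rfl⟩ := (AddCircle.homeomorphCircle hT.out.ne').surjective z
    rw [Measure.map_map (measurable_const_mul _) hmeas, AddCircle.homeomorphCircle_apply]
    conv_rhs => rw [← map_add_left_eq_self AddCircle.haarAddCircle a,
      Measure.map_map hmeas (measurable_const_add a)]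
    congr 1
    ext b
    simp only [Function.comp_apply, AddCircle.toCircle_add]
  rw [Measure.haarMeasure_unique (Measure.map _ _) ⊤, TopologicalSpace.PositiveCompacts.coe_top,
    measure_univ, one_smul, circleHaar]

theorem compMeasurePreserving_toCircle_circleFourier (n : ℤ) :
    Lp.compMeasurePreservingₗᵢ ℂ AddCircle.toCircle measurePreserving_toCircle (circleFourier n) =
      fourierLp (T := T) 2 n := by
  have hfourier : ⇑(fourier n) = circleMonomial n ∘ AddCircle.toCircle (T := T) := by
    ext x
    rw [fourier_apply, AddCircle.toCircle_zsmul, Function.comp_apply, circleMonomial_apply,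
      Circle.coe_zpow]
  refine Lp.ext ?_
  filter_upwards [Lp.coeFn_compMeasurePreserving (circleFourier n) measurePreserving_toCircle,
    measurePreserving_toCircle.quasiMeasurePreserving.ae_eq_comp
      (ContinuousMap.coeFn_toLp (p := 2) (𝕜 := ℂ) circleHaar (circleMonomial n)),
    coeFn_fourierLp (T := T) 2 n] with x hcomp hmonomial hx
  rw [hx, hfourier, ← hmonomial]
  exact hcomp

end FourierBasis

theorem orthonormal_circleFourier : Orthonormal ℂ circleFourier := by
  rw [← LinearIsometry.orthonormal_comp_iff
    (Lp.compMeasurePreservingₗᵢ ℂ AddCircle.toCircle (measurePreserving_toCircle (T := 1)))]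
  convert! orthonormal_fourier (T := (1 : ℝ)) using 1
  exact funext compMeasurePreserving_toCircle_circleFourier

theorem orthogonal_span_circleFourier :
    (Submodule.span ℂ (Set.range circleFourier))ᗮ = ⊥ := by
  rw [Submodule.eq_bot_iff]
  intro x hx
  let L := Lp.compMeasurePreservingₗᵢ ℂ (E := ℂ) (p := 2) AddCircle.toCircle
    (measurePreserving_toCircle (T := 1))
  have hrepr : fourierBasis.repr (L x) = 0 := by
    ext n
    rw [fourierBasis.repr_apply_apply, coe_fourierBasis,
      ← compMeasurePreserving_toCircle_circleFourier, L.inner_map_map]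
    exact hx _ (Submodule.subset_span ⟨n, rfl⟩)
  rwa [map_eq_zero_iff _ fourierBasis.repr.injective, map_eq_zero_iff _ L.injective] at hrepr

/-- The Fourier basis of `L²` of the circle, carried over from Mathlib's `fourierBasis` on
`AddCircle 1`. -/
noncomputable def circleFourierBasis : HilbertBasis ℤ ℂ (Lp ℂ 2 circleHaar) :=
  HilbertBasis.mkOfOrthogonalEqBot orthonormal_circleFourier orthogonal_span_circleFourier

theorem coe_circleFourierBasis : ⇑circleFourierBasis = circleFourier :=
  HilbertBasis.coe_mkOfOrthogonalEqBot ..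

/-- The trigonometric polynomials with frequencies in `[-M, M]`, as a subspace of `L²`. -/
noncomputable def trigSpace (M : ℕ) : Submodule ℂ (Lp ℂ 2 circleHaar) :=
  Submodule.span ℂ (circleFourier '' Set.Icc (-M : ℤ) M)

instance instFiniteDimensionalTrigSpace (M : ℕ) : FiniteDimensional ℂ (trigSpace M) :=
  FiniteDimensional.span_of_finite ℂ ((Set.finite_Icc _ _).image _)

theorem circleFourier_mem_trigSpace {M : ℕ} {n : ℤ} (hn : n.natAbs ≤ M) :
    circleFourier n ∈ trigSpace M :=
  Submodule.subset_span ⟨n, ⟨by omega, by omega⟩, rfl⟩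

theorem mem_trigSpace_iff {M : ℕ} {x : Lp ℂ 2 circleHaar} :
    x ∈ trigSpace M ↔ ∀ n ∉ Set.Icc (-M : ℤ) M, inner ℂ (circleFourier n) x = 0 := by
  rw [trigSpace, ← coe_circleFourierBasis]
  exact mem_span_image_hilbertBasis_iff circleFourierBasis (Set.finite_Icc _ _)

theorem circleFourier_mem_orthogonal_trigSpace {M : ℕ} {n : ℤ} (hn : n ∉ Set.Icc (-M : ℤ) M) :
    circleFourier n ∈ (trigSpace M)ᗮ := fun _ hx => by
  rw [← inner_conj_symm, mem_trigSpace_iff.1 hx n hn, map_zero]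

theorem exists_isTrigPolynomial_of_mem_trigSpace {M : ℕ} {x : Lp ℂ 2 circleHaar}
    (hx : x ∈ trigSpace M) :
    ∃ f : C(Circle, ℂ), IsTrigPolynomial f ∧ ContinuousMap.toLp 2 circleHaar ℂ f = x := by
  simp only [isTrigPolynomial_iff_mem_span]
  have hle : trigSpace M ≤ (Submodule.span ℂ (Set.range circleMonomial)).map
      (ContinuousMap.toLp 2 circleHaar ℂ : C(Circle, ℂ) →L[ℂ] _).toLinearMap := by
    rw [Submodule.map_span, ← Set.range_comp]
    exact Submodule.span_mono (Set.image_subset_range _ _)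
  exact hle hx

/-- The dilate `z ↦ f (z ^ N)`, so that the wavelet operators act on continuous functions by
`f ↦ m * dilate N f`. -/
noncomputable def dilate (N : ℕ) (f : C(Circle, ℂ)) : C(Circle, ℂ) :=
  f.comp ⟨fun z => z ^ N, continuous_pow N⟩

theorem dilate_apply (N : ℕ) (f : C(Circle, ℂ)) (z : Circle) : dilate N f z = f (z ^ N) := rfl

theorem dilate_circleMonomial (N : ℕ) (n : ℤ) :
    dilate N (circleMonomial n) = circleMonomial (N * n) := by
  ext z
  rw [dilate_apply, circleMonomial_apply, circleMonomial_apply, Circle.coe_pow, zpow_mul,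
    zpow_natCast]

/-- The image of `f` under the word `I` in the operators `g ↦ m i * dilate N g`: it realises
`CuntzRep.word` of the wavelet representation on continuous functions. -/
noncomputable def filterWord {N : ℕ} (m : Fin N → C(Circle, ℂ)) (I : List (Fin N))
    (f : C(Circle, ℂ)) : C(Circle, ℂ) :=
  I.foldr (fun i g => m i * dilate N g) f

section WaveletOp

variable {N : ℕ} (hN : 2 ≤ N)

theorem waveletOp_toLp (m f : C(Circle, ℂ)) :
    waveletOp hN m (ContinuousMap.toLp 2 circleHaar ℂ f) =
      ContinuousMap.toLp 2 circleHaar ℂ (m * dilate N f) := by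
  refine Lp.ext ?_
  have hpow := (measurePreserving_circle_pow (show N ≠ 0 by omega)).quasiMeasurePreserving
  filter_upwards [coeFn_waveletOp hN m (ContinuousMap.toLp 2 circleHaar ℂ f),
    hpow.ae_eq_comp (ContinuousMap.coeFn_toLp (p := 2) (𝕜 := ℂ) circleHaar f),
    ContinuousMap.coeFn_toLp (p := 2) (𝕜 := ℂ) circleHaar (m * dilate N f)] with z hz hf hmf
  rw [hz, hmf, ContinuousMap.mul_apply, dilate_apply]
  exact congrArg (m z * ·) hf

theorem waveletOp_circleFourier (m : C(Circle, ℂ)) (n : ℤ) :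
    waveletOp hN m (circleFourier n) =
      ContinuousMap.toLp 2 circleHaar ℂ (m * circleMonomial (N * n)) := by
  rw [circleFourier, waveletOp_toLp, dilate_circleMonomial]

theorem waveletOp_smul_circleMonomial_circleFourier (a : ℂ) (k n : ℤ) :
    waveletOp hN (a • circleMonomial k) (circleFourier n) = a • circleFourier (k + N * n) := by
  rw [waveletOp_circleFourier, smul_mul_assoc, circleMonomial_mul, map_smul, circleFourier]

theorem waveletOp_circleFourier_mem_orthogonal_trigSpace {m : C(Circle, ℂ)}
    (hm : IsTrigPolynomial m) :
    ∀ᶠ M : ℕ in atTop, ∀ l ∉ Set.Icc (-M : ℤ) M,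
      waveletOp hN m (circleFourier l) ∈ (trigSpace M)ᗮ := by
  simp only [waveletOp_circleFourier]
  rw [isTrigPolynomial_iff_mem_span] at hm
  induction hm using Submodule.span_induction with
  | mem m hm =>
    obtain ⟨k, rfl⟩ := hm
    filter_upwards [eventually_ge_atTop k.natAbs] with M hM l hl
    rw [circleMonomial_mul]
    refine circleFourier_mem_orthogonal_trigSpace fun hkl => hl ?_
    have hN' : (2 : ℤ) ≤ N := by exact_mod_cast hN
    have hk : |k| ≤ M := by
      rw [Int.abs_eq_natAbs]
      exact_mod_cast hM
    rw [Set.mem_Icc, ← abs_le] at hkl ⊢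
    have hle : 2 * |l| ≤ 2 * M :=
      calc 2 * |l| ≤ N * |l| := by gcongr
        _ = |k + N * l - k| := by rw [add_sub_cancel_left, abs_mul, Nat.abs_cast]
        _ ≤ |k + N * l| + |k| := abs_sub _ _
        _ ≤ 2 * M := by linarith
    linarith
  | zero => simp only [zero_mul, map_zero, zero_mem, implies_true, eventually_true]
  | add m m' _ _ hm hm' =>
    filter_upwards [hm, hm'] with M hM hM' l hl
    rw [add_mul, map_add]
    exact add_mem (hM l hl) (hM' l hl)
  | smul c m _ hm =>
    filter_upwards [hm] with M hM l hl
    rw [smul_mul_assoc, map_smul]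
    exact Submodule.smul_mem _ c (hM l hl)

theorem star_waveletOp_mem_trigSpace {m : C(Circle, ℂ)} (hm : IsTrigPolynomial m) :
    ∀ᶠ M in atTop, ∀ x ∈ trigSpace M, star (waveletOp hN m) x ∈ trigSpace M := by
  filter_upwards [waveletOp_circleFourier_mem_orthogonal_trigSpace hN hm] with M hM x hx
  rw [mem_trigSpace_iff]
  intro l hl
  rw [ContinuousLinearMap.star_eq_adjoint, ContinuousLinearMap.adjoint_inner_right]
  exact Submodule.inner_left_of_mem_orthogonal hx (hM l hl)

end WaveletOp

/-! ### Width of trigonometric polynomials -/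

theorem polynomial_eq_of_eval_circle_eq {p q : Polynomial ℂ}
    (h : ∀ z : Circle, p.eval (z : ℂ) = q.eval (z : ℂ)) : p = q := by
  have hsphere : (Metric.sphere (0 : ℂ) 1).Infinite :=
    (isPreconnected_sphere (by simp [Complex.rank_real_complex]) 0 1).infinite_of_nontrivial
      ⟨1, by simp, -1, by simp, by norm_num⟩
  exact p.eq_of_infinite_eval_eq q <| hsphere.mono fun z hz => h ⟨z, hz⟩

theorem eq_of_zpow_mul_eval_circle_eq {a b : ℤ} {p q : Polynomial ℂ} (hp : p.coeff 0 ≠ 0)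
    (hq : q.coeff 0 ≠ 0)
    (h : ∀ z : Circle, (z : ℂ) ^ a * p.eval (z : ℂ) = (z : ℂ) ^ b * q.eval (z : ℂ)) : p = q := by
  wlog hab : a ≤ b generalizing a b p q
  · exact (this hq hp (fun z => (h z).symm) (le_of_not_ge hab)).symm
  obtain ⟨n, rfl⟩ := Int.le.dest hab
  have hpq : p = Polynomial.X ^ n * q := polynomial_eq_of_eval_circle_eq fun z => by
    have hz := h z
    rw [zpow_add₀ (Circle.coe_ne_zero z), mul_assoc] at hz
    simpa using mul_left_cancel₀ (zpow_ne_zero a (Circle.coe_ne_zero z)) hz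
  have hn : n = 0 := by
    by_contra hn
    exact hp (by rw [hpq, Polynomial.mul_coeff_zero, Polynomial.coeff_X_pow, if_neg (Ne.symm hn),
      zero_mul])
  rw [hpq, hn, pow_zero, one_mul]

/-- `f(z) = z^a p(z)` on the circle, for a polynomial `p` of degree `d` with nonzero constant
coefficient: the trigonometric polynomial `f` is nonzero and its frequencies span an interval of
length `d`. -/
def HasWidth (f : C(Circle, ℂ)) (d : ℕ) : Prop :=
  ∃ (a : ℤ) (p : Polynomial ℂ), p.coeff 0 ≠ 0 ∧ p.natDegree = d ∧
    ∀ z : Circle, f z = (z : ℂ) ^ a * p.eval (z : ℂ)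

namespace HasWidth

variable {f g : C(Circle, ℂ)} {d e : ℕ}

theorem unique (hd : HasWidth f d) (he : HasWidth f e) : d = e := by
  obtain ⟨a, p, hp, rfl, hfp⟩ := hd
  obtain ⟨b, q, hq, rfl, hfq⟩ := he
  rw [eq_of_zpow_mul_eval_circle_eq hp hq fun z => by rw [← hfp, hfq]]

theorem mul (hf : HasWidth f d) (hg : HasWidth g e) : HasWidth (f * g) (d + e) := by
  obtain ⟨a, p, hp, rfl, hf⟩ := hf
  obtain ⟨b, q, hq, rfl, hg⟩ := hg
  have hpq : (p * q).coeff 0 ≠ 0 := by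
    rw [Polynomial.mul_coeff_zero]
    exact mul_ne_zero hp hq
  refine ⟨a + b, p * q, hpq, Polynomial.natDegree_mul ?_ ?_, fun z => ?_⟩
  · exact fun h => hp (by rw [h, Polynomial.coeff_zero])
  · exact fun h => hq (by rw [h, Polynomial.coeff_zero])
  · rw [ContinuousMap.mul_apply, hf, hg, zpow_add₀ (Circle.coe_ne_zero z), Polynomial.eval_mul,
      mul_mul_mul_comm]

theorem smul (hf : HasWidth f d) {c : ℂ} (hc : c ≠ 0) : HasWidth (c • f) d := by
  obtain ⟨a, p, hp, rfl, hf⟩ := hf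
  refine ⟨a, c • p, ?_, Polynomial.natDegree_smul p hc, fun z => ?_⟩
  · rw [Polynomial.coeff_smul]
    exact smul_ne_zero hc hp
  · rw [ContinuousMap.smul_apply, hf, Polynomial.eval_smul, mul_smul_comm]

theorem dilate (hf : HasWidth f d) {N : ℕ} (hN : 0 < N) : HasWidth (dilate N f) (d * N) := by
  obtain ⟨a, p, hp, rfl, hf⟩ := hf
  refine ⟨N * a, Polynomial.expand ℂ N p, ?_, Polynomial.natDegree_expand N p, fun z => ?_⟩
  · rwa [← zero_mul N, Polynomial.coeff_expand_mul hN]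
  · rw [dilate_apply, hf, Polynomial.expand_eval, Circle.coe_pow, zpow_mul, zpow_natCast]

theorem exists_filterWord {N : ℕ} (hN : 0 < N) {m : Fin N → C(Circle, ℂ)} {w : Fin N → ℕ}
    (hm : ∀ i, HasWidth (m i) (w i)) (hf : HasWidth f d) (I : List (Fin N)) :
    ∃ D, HasWidth (filterWord m I f) D ∧ (I.map w).sum + d * N ^ I.length ≤ D := by
  induction I with
  | nil => exact ⟨d, hf, by simp⟩
  | cons i I ih =>
    obtain ⟨D, hD, hle⟩ := ih
    refine ⟨w i + D * N, (hm i).mul (hD.dilate hN), ?_⟩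
    calc ((i :: I).map w).sum + d * N ^ (i :: I).length
        = w i + ((I.map w).sum + d * N ^ I.length * N) := by
          rw [List.map_cons, List.sum_cons, List.length_cons, pow_succ, add_assoc, mul_assoc]
      _ ≤ w i + ((I.map w).sum + d * N ^ I.length) * N := by
          rw [add_mul]
          gcongr
          exact Nat.le_mul_of_pos_right _ hN
      _ ≤ w i + D * N := by gcongr

theorem exists_eq_smul_circleMonomial (hf : HasWidth f 0) :
    ∃ (c : ℂ) (n : ℤ), f = c • circleMonomial n := by
  obtain ⟨a, p, -, hp, hf⟩ := hf
  refine ⟨p.coeff 0, a, eq_smul_circleMonomial_iff.2 fun z => ?_⟩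
  rw [hf, Polynomial.eq_C_of_natDegree_eq_zero hp, Polynomial.eval_C, Polynomial.coeff_C_zero,
    mul_comm]

end HasWidth

theorem IsTrigPolynomial.exists_hasWidth {f : C(Circle, ℂ)} (hf : IsTrigPolynomial f)
    (hf0 : f ≠ 0) : ∃ d, HasWidth f d := by
  obtain ⟨c, hc⟩ := hf
  have hsupp : c.support.Nonempty := by
    rw [Finsupp.support_nonempty_iff]
    rintro rfl
    exact hf0 (ContinuousMap.ext fun z => by rw [hc, Finsupp.sum_zero_index]; rfl)
  let a := c.support.min' hsupp
  have ha : ∀ n ∈ c.support, a ≤ n := fun n hn => c.support.min'_le n hn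
  have ha_mem : a ∈ c.support := c.support.min'_mem hsupp
  let p : Polynomial ℂ := ∑ n ∈ c.support, Polynomial.monomial (n - a).toNat (c n)
  refine ⟨p.natDegree, a, p, ?_, rfl, fun z => ?_⟩
  · have hp : p.coeff 0 = c a := by
      rw [Polynomial.finsetSum_coeff, Finset.sum_eq_single_of_mem a ha_mem]
      · simp
      · intro n hn hna
        exact Polynomial.coeff_monomial_of_ne _ (by have := ha n hn; omega)
    rw [hp]
    exact Finsupp.mem_support_iff.1 ha_mem
  · rw [hc, Finsupp.sum, Polynomial.eval_finsetSum, Finset.mul_sum]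
    refine Finset.sum_congr rfl fun n hn => ?_
    rw [Polynomial.eval_monomial, ← zpow_natCast, Int.toNat_of_nonneg (sub_nonneg.2 (ha n hn)),
      mul_left_comm, ← zpow_add₀ (Circle.coe_ne_zero z), add_sub_cancel]

/-- A word of length `n` multiplies the width by at least `N ^ n`, so an eigenvector has
width zero. -/
theorem exists_eq_smul_circleMonomial_of_filterWord_eq_smul {N : ℕ} (hN : 2 ≤ N)
    {m : Fin N → C(Circle, ℂ)} (hm : ∀ i, IsTrigPolynomial (m i)) (hm0 : ∀ i, m i ≠ 0)
    {I : List (Fin N)} (hI : I ≠ []) {f : C(Circle, ℂ)} (hf : IsTrigPolynomial f) (hf0 : f ≠ 0)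
    {c : ℂ} (hc : c ≠ 0) (h : filterWord m I f = c • f) :
    (∀ i ∈ I, ∃ (a : ℂ) (k : ℤ), m i = a • circleMonomial k) ∧
      ∃ (b : ℂ) (l : ℤ), f = b • circleMonomial l := by
  choose w hw using fun i => (hm i).exists_hasWidth (hm0 i)
  obtain ⟨d, hd⟩ := hf.exists_hasWidth hf0
  obtain ⟨D, hD, hle⟩ := hd.exists_filterWord (by omega) hw I
  obtain rfl : D = d := hD.unique (h ▸ hd.smul hc)
  have hpow : 2 ≤ N ^ I.length := hN.trans (Nat.le_pow (List.length_pos_iff.2 hI))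
  have hD2 : D * 2 ≤ D * N ^ I.length := by gcongr
  have hsum : (I.map w).sum = 0 := by omega
  obtain rfl : D = 0 := by omega
  refine ⟨fun i hi => ?_, hd.exists_eq_smul_circleMonomial⟩
  have hwi : w i = 0 := List.sum_eq_zero_iff.1 hsum _ (List.mem_map_of_mem hi)
  exact HasWidth.exists_eq_smul_circleMonomial (hwi ▸ hw i)

/-! ### Atoms of wavelet representations -/

theorem waveletRep_S {N : ℕ} (hN : 2 ≤ N) {m : Fin N → C(Circle, ℂ)} (hm : IsQMF m) (i : Fin N) :
    (waveletRep hN m hm).S i = waveletOp hN (m i) := rfl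

namespace IsQMF

variable {N : ℕ} {m : Fin N → C(Circle, ℂ)}

theorem ne_zero (hm : IsQMF m) (i : Fin N) : m i ≠ 0 := fun h => by
  simpa [h] using hm i i 1

theorem norm_eq_one_of_eq_smul_circleMonomial (hm : IsQMF m) (hN : 2 ≤ N) {i : Fin N} {a : ℂ}
    {k : ℤ} (h : m i = a • circleMonomial k) : ‖a‖ = 1 := by
  have hword : (waveletRep hN m hm).word [i] (circleFourier 0) = a • circleFourier k := by
    rw [CuntzRep.word_cons, CuntzRep.word_nil, mul_one, waveletRep_S, h,
      waveletOp_smul_circleMonomial_circleFourier, mul_zero, add_zero]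
  have hnorm := (waveletRep hN m hm).norm_word [i] (circleFourier 0)
  rwa [hword, norm_smul, orthonormal_circleFourier.1, orthonormal_circleFourier.1, mul_one]
    at hnorm

theorem sum_norm_sq_apply (hm : IsQMF m) (hN : N ≠ 0) (z : Circle) :
    ∑ i, ‖m i z‖ ^ 2 = N := by
  have hsum := hm.sum_filter hN ⟨0, by omega⟩ ⟨0, by omega⟩ z
  have hN' : (N : ℂ) ≠ 0 := by exact_mod_cast hN
  simp only [pow_zero, one_mul, if_true, Complex.conj_mul', one_div,
    inv_mul_eq_one₀ hN'] at hsum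
  exact_mod_cast hsum.symm

theorem norm_apply_ne_one_of_apply_eq_sqrt (hm : IsQMF m) (hN : 2 ≤ N) {i₀ : Fin N} {z : Circle}
    (h : m i₀ z = ((√N : ℝ) : ℂ)) (i : Fin N) : ‖m i z‖ ≠ 1 := by
  have hN' : (2 : ℝ) ≤ N := by exact_mod_cast hN
  have hi₀ : ‖m i₀ z‖ ^ 2 = N := by
    rw [h, Complex.norm_real, Real.norm_of_nonneg (Real.sqrt_nonneg _),
      Real.sq_sqrt (Nat.cast_nonneg N)]
  intro hi
  obtain rfl | hne := eq_or_ne i i₀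
  · rw [hi] at hi₀
    linarith
  · have hle : ‖m i z‖ ^ 2 + ‖m i₀ z‖ ^ 2 ≤ ∑ j, ‖m j z‖ ^ 2 :=
      Finset.add_le_sum (f := fun j => ‖m j z‖ ^ 2) (fun _ _ => by positivity) (Finset.mem_univ i)
        (Finset.mem_univ i₀) hne
    rw [hm.sum_norm_sq_apply (by omega), hi, hi₀] at hle
    linarith

end IsQMF

theorem eq_of_smul_circleFourier_eq_smul {a b : ℂ} (ha : a ≠ 0) {n l : ℤ}
    (h : a • circleFourier n = b • circleFourier l) : n = l := by
  have hsingle : Finsupp.single n a = Finsupp.single l b :=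
    orthonormal_circleFourier.linearIndependent.finsuppLinearCombination_injective (by simpa)
  exact ((Finsupp.single_eq_single_iff ..).1 hsingle).resolve_right (fun h => ha h.1) |>.1

section WaveletRep

variable {N : ℕ} (hN : 2 ≤ N) {m : Fin N → C(Circle, ℂ)} (hm : IsQMF m)

theorem word_toLp (I : List (Fin N)) (f : C(Circle, ℂ)) :
    (waveletRep hN m hm).word I (ContinuousMap.toLp 2 circleHaar ℂ f) =
      ContinuousMap.toLp 2 circleHaar ℂ (filterWord m I f) := by
  induction I with
  | nil => simp [CuntzRep.word_nil, filterWord]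
  | cons i I ih =>
    rw [CuntzRep.word_cons, mul_apply_eq_comp, ih, waveletRep_S, waveletOp_toLp]
    rfl

section Monomial

variable {p : ℕ} {i : Fin p → Fin N} {a : Fin p → ℂ} {k : Fin p → ℤ}

theorem word_ofFn_circleFourier (h : ∀ j, m (i j) = a j • circleMonomial (k j)) (n : ℤ) :
    (waveletRep hN m hm).word (List.ofFn i) (circleFourier n) =
      (∏ j, a j) • circleFourier (∑ j : Fin p, (N : ℤ) ^ (j : ℕ) * k j + N ^ p * n) := by
  induction p with
  | zero => simp [CuntzRep.word_nil]
  | succ p ih =>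
    rw [List.ofFn_succ, CuntzRep.word_cons, mul_apply_eq_comp, ih fun j => h j.succ, map_smul,
      waveletRep_S, h 0, waveletOp_smul_circleMonomial_circleFourier, smul_smul,
      Fin.prod_univ_succ, mul_comm]
    congr 2
    simp only [Fin.sum_univ_succ, Fin.val_zero, Fin.val_succ, pow_zero, one_mul, mul_add,
      Finset.mul_sum, pow_succ', mul_assoc, add_assoc]

theorem exists_word_circleFourier_eq_smul_iff (h : ∀ j, m (i j) = a j • circleMonomial (k j)) :
    (∃ (l : ℤ) (c : ℂ),
      (waveletRep hN m hm).word (List.ofFn i) (circleFourier l) = c • circleFourier l) ↔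
    (N : ℤ) ^ p - 1 ∣ ∑ j : Fin p, (N : ℤ) ^ (j : ℕ) * k j := by
  simp only [word_ofFn_circleFourier hN hm h]
  constructor
  · rintro ⟨l, c, hl⟩
    have ha : ∏ j, a j ≠ 0 := Finset.prod_ne_zero_iff.2 fun j _ => norm_ne_zero_iff.1 <| by
      rw [hm.norm_eq_one_of_eq_smul_circleMonomial hN (h j)]
      exact one_ne_zero
    refine ⟨-l, ?_⟩
    linear_combination eq_of_smul_circleFourier_eq_smul ha hl
  · rintro ⟨s, hs⟩
    refine ⟨-s, ∏ j, a j, ?_⟩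
    rw [hs]
    congr 2
    ring

end Monomial

theorem exists_word_toLp_eq_smul_of_hasAtom (hm_trig : ∀ i, IsTrigPolynomial (m i))
    (hatom : (waveletRep hN m hm).HasAtom) :
    ∃ p > 0, ∃ (i : Fin p → Fin N) (f : C(Circle, ℂ)), IsTrigPolynomial f ∧ f ≠ 0 ∧ ∃ c : ℂ,
      (waveletRep hN m hm).word (List.ofFn i) (ContinuousMap.toLp 2 circleHaar ℂ f) =
        c • ContinuousMap.toLp 2 circleHaar ℂ f := by
  obtain ⟨ω, hω⟩ := hatom
  obtain ⟨n, hn⟩ := exists_apply_hilbertBasis_ne_zero circleFourierBasis hω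
  rw [coe_circleFourierBasis] at hn
  obtain ⟨M, hM, hnM⟩ := ((eventually_all.2 fun i =>
    star_waveletOp_mem_trigSpace hN (hm_trig i)).and (eventually_ge_atTop n.natAbs)).exists
  obtain ⟨p, hp, i, y, hyM, hy, c, hc⟩ :=
    (waveletRep hN m hm).exists_word_apply_eq_smul_of_proj_singleton_ne_zero hM
      (circleFourier_mem_trigSpace hnM) hn
  obtain ⟨f, hf, rfl⟩ := exists_isTrigPolynomial_of_mem_trigSpace hyM
  exact ⟨p, hp, i, f, hf, fun h => hy (by rw [h, map_zero]), c, hc⟩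

theorem hasAtom_waveletRep_iff (hm_trig : ∀ i, IsTrigPolynomial (m i)) :
    (waveletRep hN m hm).HasAtom ↔
      ∃ (p : ℕ) (i : Fin p → Fin N) (a : Fin p → Circle) (k : Fin p → ℤ), 0 < p ∧
        (∀ j, m (i j) = (a j : ℂ) • circleMonomial (k j)) ∧
        (N : ℤ) ^ p - 1 ∣ ∑ j : Fin p, (N : ℤ) ^ (j : ℕ) * k j := by
  constructor
  · intro hatom
    obtain ⟨p, hp, i, f, hf, hf0, c, hc⟩ :=
      exists_word_toLp_eq_smul_of_hasAtom hN hm hm_trig hatom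
    have hLf : ContinuousMap.toLp 2 circleHaar ℂ f ≠ 0 :=
      (map_ne_zero_iff _ (ContinuousMap.toLp_injective circleHaar)).2 hf0
    have hc0 : c ≠ 0 := CuntzRep.ne_zero_of_word_apply_eq_smul _ hLf hc
    have hword : filterWord m (List.ofFn i) f = c • f :=
      ContinuousMap.toLp_injective circleHaar (by rw [← word_toLp hN hm, hc, map_smul])
    obtain ⟨hmono, b, l, rfl⟩ := exists_eq_smul_circleMonomial_of_filterWord_eq_smul hN hm_trig
      hm.ne_zero (by simpa using hp.ne') hf hf0 hc0 hword
    choose a k hak using fun j => hmono (i j) (List.mem_ofFn.2 ⟨j, rfl⟩)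
    have ha : ∀ j, ‖a j‖ = 1 := fun j => hm.norm_eq_one_of_eq_smul_circleMonomial hN (hak j)
    refine ⟨p, i, fun j => ⟨a j, mem_sphere_zero_iff_norm.2 (ha j)⟩, k, hp, hak,
      (exists_word_circleFourier_eq_smul_iff hN hm hak).1 ⟨l, c, ?_⟩⟩
    have hb : b ≠ 0 := (smul_ne_zero_iff.1 hf0).1
    rw [map_smul, map_smul, smul_comm] at hc
    exact smul_right_injective _ hb hc
  · rintro ⟨p, i, a, k, hp, hmono, hdvd⟩
    obtain ⟨l, c, hl⟩ := (exists_word_circleFourier_eq_smul_iff hN hm hmono).2 hdvd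
    exact CuntzRep.hasAtom_of_word_apply_eq_smul _ hp i (orthonormal_circleFourier.ne_zero l) hl

end WaveletRep

theorem theorem5 (N : ℕ) (hN : 2 ≤ N) (m : Fin N → C(Circle, ℂ)) (hm : IsQMF m)
    (htrig : ∀ i, IsTrigPolynomial (m i)) :
    ((waveletRep hN m hm).HasAtom ↔
      ∃ (p : ℕ) (i : Fin p → Fin N) (a : Fin p → Circle) (k : Fin p → ℤ), 1 ≤ p ∧
        (∀ (j : Fin p) (z : Circle), m (i j) z = (a j : ℂ) * (z : ℂ) ^ k j) ∧
        (N : ℤ) ^ p - 1 ∣ ∑ j : Fin p, (N : ℤ) ^ (j : ℕ) * k j) ∧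
    (m ⟨0, by omega⟩ 1 = ((Real.sqrt N : ℝ) : ℂ) → ¬ (waveletRep hN m hm).HasAtom) := by
  have hiff := hasAtom_waveletRep_iff hN hm htrig
  simp only [eq_smul_circleMonomial_iff] at hiff
  refine ⟨hiff, fun hlow hatom => ?_⟩
  obtain ⟨p, i, a, k, hp, hmono, -⟩ := hiff.1 hatom
  refine hm.norm_apply_ne_one_of_apply_eq_sqrt hN hlow (i ⟨0, hp⟩) ?_
  rw [hmono, norm_mul, norm_zpow, Circle.norm_coe, Circle.norm_coe, one_zpow, one_mul]
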